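/- An anonymous game with $n$ players and $k$ strategies has a common strategy set $\{1,\dots,k\}$, and the utility $u_i$ of player $i$ is a function (possibly different for each player) of $i$'s own strategy and of the vector $(x_1,\dots,x_k)$, where $x_j$ is the number of other players on strategy $j$. The game is given by the explicit table of all values $u_i(a;x_1,\dots,x_k)$, with $x_1+\dots+x_k=n-1$; for constant $k$ this table has size polynomial in $n$. The state graph of a game has the strategy profiles as vertices and an arc from $s$ to $s'$ whenever $s'$ arises from $s$ by a change of strategy of a single player that strictly increases this player's utility. A sink equilibrium is a strongly connected component of the state graph (possibly a single vertex) that no arc leaves. The problem \textsc{In a Sink} asks, given a game and a strategy profile $s$ of it, whether $s$ belongs to some sink equilibrium. Theorem. There is a constant $k$ such that \textsc{In a Sink} is PSPACE-hard (under polynomial-time many-one reductions) for anonymous games with $k$ strategies and with all utilities in $\{0,1,2\}$. -/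

import Mathlib

open Function

/-! ### Strategic games, state graphs and sink equilibria -/

/-- A strategic game with set of players `N`, strategy sets `S i` and real utilities. -/
structure StrategicGame (N : Type) (S : N → Type) where
  /-- the utility of each player in each strategy profile -/
  utility : N → (∀ i, S i) → ℝ

namespace StrategicGame

variable {N : Type} [DecidableEq N] {S : N → Type}

/-- The arcs of the state graph: a single player moves and improves his own utility. -/
def Arc (G : StrategicGame N S) (s t : ∀ i, S i) : Prop :=
  ∃ (i : N) (a : S i), t = update s i a ∧ G.utility i s < G.utility i t

/-- There is a (possibly empty) directed walk from `s` to `t` in the state graph. -/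
def Reachable (G : StrategicGame N S) (s t : ∀ i, S i) : Prop :=
  Relation.ReflTransGen G.Arc s t

/-- `T` is a strongly connected component of the state graph. -/
def IsStronglyConnectedComponent (G : StrategicGame N S) (T : Set (∀ i, S i)) : Prop :=
  ∃ s, T = {t | G.Reachable s t ∧ G.Reachable t s}

/-- A sink equilibrium: a strongly connected component of the state graph that no arc leaves. -/
def IsSinkEquilibrium (G : StrategicGame N S) (T : Set (∀ i, S i)) : Prop :=
  G.IsStronglyConnectedComponent T ∧ ∀ s ∈ T, ∀ t, G.Arc s t → t ∈ T

end StrategicGame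

/-! ### Anonymous games -/

/-- A distribution of `m` players over `k` strategies: strategy `j` is played by `x j` players. -/
abbrev PlayerPartition (k m : ℕ) : Type := {x : Fin k → ℕ // ∑ j, x j = m}

/-- An anonymous game with `n` players, the common strategy set `Fin k` and utilities in
`{0, 1, 2}`. The utility of a player is a function (which may differ from player to player) of his
own strategy and of the numbers of other players on each strategy. -/
@[ext]
structure AnonymousGame (n k : ℕ) where
  /-- utility of a player, by his own strategy and the partition of the `n - 1` other players -/
  util : Fin n → Fin k → PlayerPartition k (n - 1) → Fin 3

namespace AnonymousGame

variable {n k : ℕ}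

/-- The partition of the players other than `i` in the profile `s`. -/
def others (s : Fin n → Fin k) (i : Fin n) : PlayerPartition k (n - 1) :=
  ⟨fun j => ((Finset.univ.erase i).filter fun i' => s i' = j).card, by
    rw [← Finset.card_eq_sum_card_fiberwise (f := s) (t := Finset.univ) (by intro x _; simp)]
    simp⟩

/-- The underlying strategic game. -/
def toStrategicGame (G : AnonymousGame n k) : StrategicGame (Fin n) (fun _ => Fin k) where
  utility i s := ((G.util i (s i) (others s i) : ℕ) : ℝ)

end AnonymousGame

/-! ### The decision problem and its instances -/

/-- An instance of the problem In a Sink for anonymous games with `k` strategies: a game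
together with a strategy profile. -/
structure SinkInstance (k : ℕ) where
  /-- the number of players -/
  n : ℕ
  /-- the game -/
  game : AnonymousGame n k
  /-- the strategy profile -/
  profile : Fin n → Fin k

/-- The problem In a Sink for anonymous games with `k` strategies and utilities in `{0, 1, 2}`:
the set of its yes-instances, in which the profile belongs to some sink equilibrium. -/
def InASink (k : ℕ) : Set (SinkInstance k) :=
  {I | ∃ T, I.game.toStrategicGame.IsSinkEquilibrium T ∧ I.profile ∈ T}

/-- The alphabet in which instances are written. -/
inductive InstanceSymbol (k : ℕ)
  | tick
  | sep
  | util (v : Fin 3)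
  | strategy (a : Fin k)
  deriving DecidableEq, Fintype

/-- All partitions of `m` players over `k` strategies, in lexicographic order. -/
def allPartitions (k m : ℕ) : List (PlayerPartition k m) :=
  (List.Nat.antidiagonalTuple k m).attach.map fun x =>
    ⟨x.1, List.Nat.mem_antidiagonalTuple.1 x.2⟩

theorem mem_allPartitions {k m : ℕ} (x : PlayerPartition k m) : x ∈ allPartitions k m := by
  simp only [allPartitions, List.mem_map, List.mem_attach, true_and, Subtype.exists]
  exact ⟨x.1, List.Nat.mem_antidiagonalTuple.2 x.2, rfl⟩

namespace SinkInstance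

/-- The full table of the utilities, listed by player, then own strategy, then partition. -/
def utilityTable {n k : ℕ} (G : AnonymousGame n k) : List (InstanceSymbol k) :=
  (List.finRange n).flatMap fun i => (List.finRange k).flatMap fun a =>
    (allPartitions k (n - 1)).map fun x => InstanceSymbol.util (G.util i a x)

/-- The word that represents an instance: the number of players in unary, a separator, the explicit
table of all utilities, and the list of the strategies in the profile. -/
def encode {k : ℕ} (I : SinkInstance k) : List (InstanceSymbol k) :=
  List.replicate I.n InstanceSymbol.tick ++ InstanceSymbol.sep ::
    (utilityTable I.game ++ (List.finRange I.n).map fun i => InstanceSymbol.strategy (I.profile i))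

theorem flatMap_inj {α β : Type} {f g : α → List β} (hl : ∀ a, (f a).length = (g a).length)
    {l : List α} (h : l.flatMap f = l.flatMap g) : ∀ a ∈ l, f a = g a := by
  induction l with
  | nil => simp
  | cons b l ih =>
    simp only [List.flatMap_cons] at h
    obtain ⟨h1, h2⟩ := List.append_inj h (hl b)
    intro a ha
    rcases List.mem_cons.1 ha with rfl | ha
    · exact h1
    · exact ih h2 a ha

theorem encode_injective (k : ℕ) : Injective (encode (k := k)) := by
  rintro ⟨n, G, s⟩ ⟨n', G', s'⟩ h
  have hn : n = n' := by
    have := congrArg (List.count InstanceSymbol.tick) h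
    simpa [encode, utilityTable, List.count_flatMap, List.count_eq_zero.2, comp_def,
      List.count_cons, List.count_replicate] using this
  subst hn
  simp only [encode, List.append_cancel_left_eq, List.cons.injEq, true_and] at h
  obtain ⟨h1, h2⟩ := List.append_inj' h (by simp)
  have hs : s = s' := by
    funext i
    simpa using List.map_inj_left.1 h2 i (List.mem_finRange i)
  have hG : G = G' := by
    ext i a x : 4
    have h3 := flatMap_inj (by simp [List.length_flatMap]) h1 i (List.mem_finRange i)
    have h4 := flatMap_inj (by simp) h3 a (List.mem_finRange a)
    simpa using List.map_inj_left.1 h4 x (mem_allPartitions x)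
  rw [hs, hG]

open Classical in
/-- The encoding of instances as words over a finite alphabet. -/
noncomputable def encoding (k : ℕ) : Computability.Encoding (SinkInstance k) (InstanceSymbol k) where
  encode := encode
  decode l := if h : ∃ I, encode I = l then some h.choose else none
  decode_encode I := by
    have h : ∃ J : SinkInstance k, encode J = encode I := ⟨I, rfl⟩
    rw [dif_pos h]
    exact congrArg some (encode_injective k h.choose_spec)

end SinkInstance

/-! ### Polynomial space and hardness -/

/-- A deterministic single-tape Turing machine with binary input. The tape is infinite to the right;
the machine halts where no transition is given. -/
structure TapeMachine where
  /-- the states -/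
  State : Type
  /-- the tape alphabet -/
  Symbol : Type
  [stateFintype : Fintype State]
  [symbolFintype : Fintype Symbol]
  /-- the blank symbol -/
  blank : Symbol
  /-- the input symbols -/
  input : Bool ↪ Symbol
  input_ne_blank : ∀ b, input b ≠ blank
  /-- the initial state -/
  start : State
  /-- the accepting states -/
  accepting : Set State
  /-- the next state, the symbol to write and the direction of the head's move -/
  trans : State → Symbol → Option (State × Symbol × Turing.Dir)

namespace TapeMachine

/-- A configuration: the state, the position of the head and the content of the tape. -/
structure Cfg (M : TapeMachine) where
  /-- the current state -/
  state : M.State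
  /-- the current position of the head -/
  head : ℕ
  /-- the current content of the tape -/
  tape : ℕ → M.Symbol

/-- The head moves by one cell; moving left on the leftmost cell has no effect. -/
def move : Turing.Dir → ℕ → ℕ
  | Turing.Dir.left, p => p - 1
  | Turing.Dir.right, p => p + 1

/-- One step of the machine; `none` if it halts. -/
def step (M : TapeMachine) (c : M.Cfg) : Option M.Cfg :=
  (M.trans c.state (c.tape c.head)).map fun r =>
    ⟨r.1, move r.2.2 c.head, update c.tape c.head r.2.1⟩

/-- The initial configuration on input `w`. -/
def init (M : TapeMachine) (w : List Bool) : M.Cfg where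
  state := M.start
  head := 0
  tape i := (w[i]?).elim M.blank M.input

/-- `M` decides `L` in space `p`: on each input `w` it never leaves the first `p (length of w)`
cells, and it halts, in an accepting state if and only if `w ∈ L`. -/
def DecidesInSpace (M : TapeMachine) (L : Set (List Bool)) (p : ℕ → ℕ) : Prop :=
  ∀ w : List Bool,
    (∀ c, StateTransition.Reaches M.step (M.init w) c → c.head < p w.length) ∧
    ∃ c, StateTransition.Reaches M.step (M.init w) c ∧ M.step c = none ∧
      (c.state ∈ M.accepting ↔ w ∈ L)

end TapeMachine

/-- The complexity class PSPACE. -/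
def PSPACE : Set (Set (List Bool)) :=
  {L | ∃ (M : TapeMachine) (p : Polynomial ℕ), M.DecidesInSpace L fun n => p.eval n}

/-- A decision problem `P`, whose instances are written as words by `e`, is PSPACE-hard: every
language in PSPACE has a polynomial-time many-one reduction to `P`. -/
def PSPACEHard {α Γ : Type} [Fintype Γ] (e : Computability.Encoding α Γ) (P : Set α) : Prop :=
  ∀ L ∈ PSPACE, ∃ f : List Bool → α,
    Nonempty (Turing.TM2ComputableInPolyTime (Computability.encodingList Bool).encode e.encode f) ∧
    ∀ w, w ∈ L ↔ f w ∈ P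

/-! Let a deterministic machine decide a language in polynomial space. It is simulated by a machine
that accesses one bit per step, halts on rejection, and on acceptance restores the initial tape and
starts afresh, so that the initial configuration recurs exactly if the input is accepted. The bit
machine becomes an anonymous game in which every profile of the simulated play has at most one
outgoing arc. If the configuration recurs, its profile lies on a cycle of forced arcs, which no arc
leaves (`mem_sink_of_cycle`). Otherwise the play ends in a profile without arcs, from which there is
no return (`not_mem_sink`).

The difficulty is anonymity: nobody can see the value of one particular bit. The game has a player
for each bit, two blocks of players that serve as unary counters, and a clock. The first counter
holds the code `2 * c + o % 2`, where `c` is the control state and `o` the number of bits with value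
1. When the addressed bit player moves to strategy 2, the number of ones drops by exactly the value
of the bit, so a comparison with the stored parity reveals this value to everyone. The second
counter then moves, unit by unit, to the code of the next control state with the parity valid after
the write; meanwhile the first counter keeps the old code visible. The clock moves to 5, the
addressed player takes the new value, the clock moves to 6 if the counters differ, the first counter
copies the second, and the clock returns to 0. `Step.path` assembles these forced moves, and
`mem_sink_iff` combines both simulations.

For the running time, structured counter programs are translated into multi-stack machines step by
step (`Exec.iterate_step`). The functions, predicates and words that they can handle in polynomial
time (`PolyDef`, `PolyPred`, `PolyWord`) are closed under arithmetic, bounded sums, case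
distinctions and listing, so the explicit table of the game is seen to be computable by following
its definition. -/

/-! ### Counter programs and their translation to multi-stack machines -/

/-- The memory of a counter program: counters, an input word with a reading position (the two parts
of a zipper) and the word that has been written, latest symbol first. -/
structure CounterStore (Γ : Type) where
  /-- the counters -/
  reg : ℕ → ℕ
  /-- the input from the reading position on -/
  rt : List Bool
  /-- the input before the reading position, reversed -/
  lt : List Bool
  /-- the output -/
  out : List Γ

/-- Elementary operations of counter programs. -/
inductive CounterOp (Γ : Type)
  | inc (r : ℕ)
  | dec (r : ℕ)
  | right
  | left
  | drop
  | emit (c : Γ)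

/-- Elementary tests of counter programs. -/
inductive CounterTest
  | pos (r : ℕ)
  | right
  | left
  | one

/-- Structured counter programs. -/
inductive CounterProg (Γ : Type)
  | skip
  | op (o : CounterOp Γ)
  | seq (p q : CounterProg Γ)
  | ite (b : CounterTest) (p q : CounterProg Γ)
  | while (b : CounterTest) (p : CounterProg Γ)

namespace CounterOp

variable {Γ : Type}

/-- The effect of an operation. -/
def run : CounterOp Γ → CounterStore Γ → CounterStore Γ
  | inc r, s => { s with reg := update s.reg r (s.reg r + 1) }
  | dec r, s => { s with reg := update s.reg r (s.reg r - 1) }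
  | right, s => { s with rt := s.rt.tail, lt := s.rt.head?.toList ++ s.lt }
  | left, s => { s with lt := s.lt.tail, rt := s.lt.head?.toList ++ s.rt }
  | drop, s => { s with rt := s.rt.tail }
  | emit c, s => { s with out := c :: s.out }

/-- A strict upper bound for the counters that an operation uses. -/
def bound : CounterOp Γ → ℕ
  | inc r => r + 1
  | dec r => r + 1
  | _ => 0

end CounterOp

namespace CounterTest

/-- The truth value of a test. -/
def holds {Γ : Type} : CounterTest → CounterStore Γ → Bool
  | pos r, s => s.reg r != 0
  | right, s => !s.rt.isEmpty
  | left, s => !s.lt.isEmpty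
  | one, s => s.rt.head? == some true

/-- A strict upper bound for the counters that a test uses. -/
def bound : CounterTest → ℕ
  | pos r => r + 1
  | _ => 0

end CounterTest

/-- The stacks of the machine for a program with `R` counters. -/
inductive CounterStack (R : ℕ)
  | ctr (r : Fin R)
  | rt
  | lt
  | out
  deriving DecidableEq, Fintype

namespace CounterStack

/-- The alphabets of the stacks. -/
def alphabet (Γ : Type) {R : ℕ} : CounterStack R → Type
  | ctr _ => Unit
  | rt => Bool
  | lt => Bool
  | out => Γ

/-- The stacks that represent the memory of a counter program. -/
def ofStore {Γ : Type} (R : ℕ) (s : CounterStore Γ) : ∀ k : CounterStack R, List (k.alphabet Γ)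
  | ctr r => List.replicate (s.reg r) ()
  | rt => s.rt
  | lt => s.lt
  | out => s.out

end CounterStack

namespace CounterProg

variable {Γ : Type}

/-- `Exec p s t s'`: the program `p`, started in `s`, stops in `s'` after `t` steps. -/
inductive Exec : CounterProg Γ → CounterStore Γ → ℕ → CounterStore Γ → Prop
  -- The costs match the machine exactly: an operation or a test is one statement, hence one step,
  -- while `skip` and sequencing only affect labels.
  | skip (s) : Exec skip s 0 s
  | op (o : CounterOp Γ) (s) : Exec (op o) s 1 (o.run s)
  | seq {p q s t s' t' s''} : Exec p s t s' → Exec q s' t' s'' → Exec (seq p q) s (t + t') s''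
  | iteT {b : CounterTest} {p q s t s'} : b.holds s = true → Exec p s t s' →
      Exec (ite b p q) s (1 + t) s'
  | iteF {b : CounterTest} {p q s t s'} : b.holds s = false → Exec q s t s' →
      Exec (ite b p q) s (1 + t) s'
  | whileF {b : CounterTest} {p s} : b.holds s = false → Exec (.while b p) s 1 s
  | whileT {b : CounterTest} {p s t s' t' s''} : b.holds s = true → Exec p s t s' →
      Exec (.while b p) s' t' s'' → Exec (.while b p) s (1 + t + t') s''

/-- A strict upper bound for the counters that a program uses. -/
def bound : CounterProg Γ → ℕ
  | skip => 0
  | op o => o.bound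
  | seq p q => max p.bound q.bound
  | ite b p q => max b.bound (max p.bound q.bound)
  | .while b p => max b.bound p.bound

/-- The positions in a program. -/
def Pos : CounterProg Γ → Type
  | skip => Empty
  | op _ => Unit
  | seq p q => Pos p ⊕ Pos q
  | ite _ p q => Option (Pos p ⊕ Pos q)
  | .while _ p => Option (Pos p)

theorem finite_pos : ∀ p : CounterProg Γ, Finite p.Pos
  | skip => inferInstanceAs (Finite Empty)
  | op _ => inferInstanceAs (Finite Unit)
  | seq p q => by
    have := finite_pos p
    have := finite_pos q
    exact inferInstanceAs (Finite (p.Pos ⊕ q.Pos))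
  | ite _ p q => by
    have := finite_pos p
    have := finite_pos q
    exact inferInstanceAs (Finite (Option (p.Pos ⊕ q.Pos)))
  | .while _ p => by
    have := finite_pos p
    exact inferInstanceAs (Finite (Option p.Pos))

section Code

variable {Λ : Type} (R : ℕ)

/-- Statements of machines that run counter programs. -/
abbrev Code (Γ Λ : Type) (R : ℕ) : Type :=
  Turing.TM2.Stmt (CounterStack.alphabet Γ (R := R)) Λ (Option Bool)

/-- The statement for an operation. -/
def opCode (l : Λ) : CounterOp Γ → Code Γ Λ R
  | .inc r => if h : r < R then .push (.ctr ⟨r, h⟩) (fun _ => ()) (.goto fun _ => l)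
      else .goto fun _ => l
  | .dec r => if h : r < R then .pop (.ctr ⟨r, h⟩) (fun v _ => v) (.goto fun _ => l)
      else .goto fun _ => l
  -- The internal variable carries the popped symbol to the other stack and is reset to `none`, the
  -- value from which every statement starts.
  | .right => .pop .rt (fun _ (o : Option Bool) => o) (.branch Option.isSome
      (.push .lt (fun v : Option Bool => (v.getD false : Bool)) (.load (fun _ => none) (.goto fun _ => l)))
      (.goto fun _ => l))
  | .left => .pop .lt (fun _ (o : Option Bool) => o) (.branch Option.isSome
      (.push .rt (fun v : Option Bool => (v.getD false : Bool)) (.load (fun _ => none) (.goto fun _ => l)))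
      (.goto fun _ => l))
  | .drop => .pop .rt (fun v _ => v) (.goto fun _ => l)
  | .emit c => .push .out (fun _ => c) (.goto fun _ => l)

/-- A conditional jump. -/
def jump (l l' : Λ) : Code Γ Λ R :=
  .branch Option.isSome (.load (fun _ => none) (.goto fun _ => l)) (.goto fun _ => l')

/-- The statement for a test. -/
def testCode (l l' : Λ) : CounterTest → Code Γ Λ R
  | .pos r => if h : r < R then .peek (.ctr ⟨r, h⟩) (fun _ o => o.map fun _ => true) (jump R l l')
      else .goto fun _ => l
  | .right => .peek .rt (fun _ (o : Option Bool) => o) (jump R l l')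
  | .left => .peek .lt (fun _ (o : Option Bool) => o) (jump R l l')
  | .one => .peek .rt (fun _ (o : Option Bool) => o.filter id) (jump R l l')

/-- The label at which a program is entered. -/
def entry : (p : CounterProg Γ) → (p.Pos → Λ) → Λ → Λ
  | skip, _, l => l
  | op _, e, _ => e ()
  | seq p q, e, l => entry p (fun x => e (.inl x)) (entry q (fun x => e (.inr x)) l)
  | ite _ _ _, e, _ => e none
  | .while _ _, e, _ => e none

/-- The statements of a program. -/
def code : (p : CounterProg Γ) → (p.Pos → Λ) → Λ → p.Pos → Code Γ Λ R
  | skip, _, _ => fun x => Empty.elim x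
  | op o, _, l => fun _ => opCode R l o
  | seq p q, e, l => fun x => Sum.elim
      (code p (fun x => e (.inl x)) (entry q (fun x => e (.inr x)) l))
      (code q (fun x => e (.inr x)) l) x
  | ite b p q, e, l => fun x => Option.elim x
      (testCode R (entry p (fun x => e (some (.inl x))) l) (entry q (fun x => e (some (.inr x))) l) b)
      (Sum.elim (code p (fun x => e (some (.inl x))) l) (code q (fun x => e (some (.inr x))) l))
  | .while b p, e, l => fun x => Option.elim x
      (testCode R (entry p (fun x => e (some x)) (e none)) l b)
      (code p (fun x => e (some x)) (e none))

/-- The machine configuration with label `l` that represents the memory `s`. -/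
def toCfg (l : Λ) (s : CounterStore Γ) :
    Turing.TM2.Cfg (CounterStack.alphabet Γ (R := R)) Λ (Option Bool) :=
  ⟨some l, none, CounterStack.ofStore R s⟩

variable {R}

/-- A stack over a one-letter alphabet is a unary counter, so push and pop are increment and
truncated decrement; the bound guarantees that the counter has a stack. -/
theorem opCode_spec (o : CounterOp Γ) (l : Λ) (s : CounterStore Γ) (ho : o.bound ≤ R) :
    Turing.TM2.stepAux (opCode R l o) none (CounterStack.ofStore R s) = toCfg R l (o.run s) := by
  cases o with
  | inc r =>
    have h : r < R := ho
    simp only [opCode, h, dif_pos, Turing.TM2.stepAux, toCfg, CounterOp.run]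
    congr 1
    funext k
    cases k with
    | ctr r' =>
      by_cases hr : r' = ⟨r, h⟩
      · subst hr
        simp only [CounterStack.ofStore, update_self]
        rfl
      · have : (r' : ℕ) ≠ r := fun h => hr (Fin.ext h)
        simp [CounterStack.ofStore, hr, this]
    | _ => rfl
  | dec r =>
    have h : r < R := ho
    simp only [opCode, h, dif_pos, Turing.TM2.stepAux, toCfg, CounterOp.run]
    congr 1
    funext k
    cases k with
    | ctr r' =>
      by_cases hr : r' = ⟨r, h⟩
      · subst hr
        simp only [CounterStack.ofStore, update_self]
        exact List.tail_replicate ..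
      · have : (r' : ℕ) ≠ r := fun h => hr (Fin.ext h)
        simp [CounterStack.ofStore, hr, this]
    | _ => rfl
  | right =>
    obtain ⟨reg, _ | ⟨b, rt⟩, lt, out⟩ := s
    all_goals
      refine congrArg (Turing.TM2.Cfg.mk (some l) none) ?_
      funext k
      cases k <;> rfl
  | left =>
    obtain ⟨reg, rt, _ | ⟨b, lt⟩, out⟩ := s
    all_goals
      refine congrArg (Turing.TM2.Cfg.mk (some l) none) ?_
      funext k
      cases k <;> rfl
  | drop =>
    refine congrArg (Turing.TM2.Cfg.mk (some l) none) ?_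
    funext k
    cases k <;> rfl
  | emit c =>
    refine congrArg (Turing.TM2.Cfg.mk (some l) none) ?_
    funext k
    cases k <;> rfl

theorem jump_spec (l l' : Λ) (v : Option Bool) (S : ∀ k : CounterStack R, List (k.alphabet Γ)) :
    Turing.TM2.stepAux (jump R l l') v S = ⟨some (if v.isSome then l else l'), none, S⟩ := by
  cases v <;> rfl

theorem testCode_spec (b : CounterTest) (l l' : Λ) (s : CounterStore Γ) (hb : b.bound ≤ R) :
    Turing.TM2.stepAux (testCode R l l' b) none (CounterStack.ofStore R s) =
      toCfg R (if b.holds s then l else l') s := by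
  have key : ∀ v : Option Bool, v.isSome = b.holds s →
      Turing.TM2.stepAux (jump R l l') v (CounterStack.ofStore R s) =
      toCfg R (if b.holds s then l else l') s := by
    intro v hv
    rw [jump_spec, hv]
    rfl
  cases b with
  | pos r =>
    have h : r < R := hb
    simp only [testCode, h, dif_pos, Turing.TM2.stepAux]
    refine key _ ?_
    simp only [Option.isSome_map, CounterTest.holds]
    change (List.replicate (s.reg r) ()).head?.isSome = _
    cases s.reg r <;> rfl
  | right =>
    refine key _ ?_
    change s.rt.head?.isSome = !s.rt.isEmpty
    cases s.rt <;> rfl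
  | left =>
    refine key _ ?_
    change s.lt.head?.isSome = !s.lt.isEmpty
    cases s.lt <;> rfl
  | one =>
    refine key _ ?_
    change (s.rt.head?.filter id).isSome = (s.rt.head? == some true)
    rcases s.rt with _ | ⟨_ | _, _⟩ <;> rfl

/-- The machine for a program runs it in as many steps as the program takes. -/
theorem Exec.iterate_step {p : CounterProg Γ} {s s' : CounterStore Γ} {t : ℕ} (h : Exec p s t s')
    (m : Λ → Code Γ Λ R) (e : p.Pos → Λ) (l : Λ) (hm : ∀ x, m (e x) = code R p e l x)
    (hR : p.bound ≤ R) :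
    (flip bind (Turing.TM2.step m))^[t] (some (toCfg R (entry p e l) s)) = some (toCfg R l s') := by
  induction h generalizing l with
  | skip s => rfl
  | op o s =>
    have := hm ()
    simp only [iterate_one, flip, entry, toCfg, Option.bind_eq_bind, Option.bind_some,
      Turing.TM2.step, this]
    exact congrArg some (opCode_spec o l s hR)
  | seq h1 h2 ih1 ih2 =>
    rw [add_comm, iterate_add_apply]
    simp only [bound, max_le_iff] at hR
    rw [entry, ih1 _ _ (fun x => hm (.inl x)) hR.1]
    exact ih2 _ _ (fun x => hm (.inr x)) hR.2
  | @iteT b p q s t s' hb h ih =>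
    simp only [bound, max_le_iff] at hR
    rw [add_comm, iterate_add_apply, iterate_one]
    have h0 := hm none
    have : flip bind (Turing.TM2.step m) (some (toCfg R (entry (ite b p q) e l) s)) =
        some (toCfg R (entry p (fun x => e (some (.inl x))) l) s) := by
      simp only [flip, entry, toCfg, Option.bind_eq_bind, Option.bind_some, Turing.TM2.step, h0]
      refine congrArg some ((testCode_spec b _ _ s hR.1).trans ?_)
      simp [hb, toCfg]
    rw [this]
    exact ih _ _ (fun x => hm (some (.inl x))) hR.2.1
  | @iteF b p q s t s' hb h ih =>
    simp only [bound, max_le_iff] at hR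
    rw [add_comm, iterate_add_apply, iterate_one]
    have h0 := hm none
    have : flip bind (Turing.TM2.step m) (some (toCfg R (entry (ite b p q) e l) s)) =
        some (toCfg R (entry q (fun x => e (some (.inr x))) l) s) := by
      simp only [flip, entry, toCfg, Option.bind_eq_bind, Option.bind_some, Turing.TM2.step, h0]
      refine congrArg some ((testCode_spec b _ _ s hR.1).trans ?_)
      simp [hb, toCfg]
    rw [this]
    exact ih _ _ (fun x => hm (some (.inr x))) hR.2.2
  | @whileF b p s hb =>
    simp only [bound, max_le_iff] at hR
    have h0 := hm none
    simp only [iterate_one, flip, entry, toCfg, Option.bind_eq_bind, Option.bind_some,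
      Turing.TM2.step, h0]
    refine congrArg some ((testCode_spec b _ _ s hR.1).trans ?_)
    simp [hb, toCfg]
  | @whileT b p s t s' t' s'' hb h1 h2 ih1 ih2 =>
    have hR' := hR
    simp only [bound, max_le_iff] at hR
    rw [add_comm, iterate_add_apply, add_comm 1, iterate_add_apply, iterate_one]
    have h0 := hm none
    have : flip bind (Turing.TM2.step m) (some (toCfg R (entry (.while b p) e l) s)) =
        some (toCfg R (entry p (fun x => e (some x)) (e none)) s) := by
      simp only [flip, entry, toCfg, Option.bind_eq_bind, Option.bind_some, Turing.TM2.step, h0]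
      refine congrArg some ((testCode_spec b _ _ s hR.1).trans ?_)
      simp [hb, toCfg]
    rw [this, ih1 _ _ (fun x => hm (some x)) hR.2]
    exact ih2 _ _ hm hR'

end Code

/-- The multi-stack machine that runs a counter program. -/
noncomputable def machine (p : CounterProg Γ) : Turing.FinTM2 :=
  have := p.finite_pos
  have : Fintype p.Pos := Fintype.ofFinite _
  { K := CounterStack p.bound
    k₀ := .rt
    k₁ := .out
    Γ := CounterStack.alphabet Γ
    Λ := Option p.Pos
    main := entry p some none
    σ := Option Bool
    initialState := none
    Γk₀Fin := inferInstanceAs (Fintype Bool)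
    m := fun x => x.elim .halt (code p.bound p some none) }

/-- A function is computable in polynomial time if a counter program writes its values in polynomial
time and clears its memory. -/
theorem tm2ComputableInPolyTime {β : Type} (eb : β → List Γ) (f : List Bool → β)
    (p : CounterProg Γ) (P : Polynomial ℕ)
    (h : ∀ w, ∃ t ≤ P.eval w.length, Exec p ⟨fun _ => 0, w, [], []⟩ t ⟨fun _ => 0, [], [], eb (f w)⟩) :
    Nonempty (Turing.TM2ComputableInPolyTime (Computability.encodingList Bool).encode eb f) := by
  choose t ht hE using h
  -- The additional step executes `halt` at the exit label `none`.
  refine ⟨⟨⟨p.machine, Equiv.refl _, Equiv.refl _⟩, P + 1, fun w => ⟨⟨1 + t w, ?_⟩, ?_⟩⟩⟩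
  · have h1 := (hE w).iterate_step (R := p.bound) (Λ := Option p.Pos)
      (fun x => x.elim .halt (code p.bound p some none)) some none (fun x => rfl) le_rfl
    rw [iterate_add_apply]
    have h2 : Turing.initList p.machine (List.map (Equiv.refl Bool).invFun
        ((Computability.encodingList Bool).encode w)) =
        toCfg p.bound (entry p some none) ⟨fun _ => 0, w, [], []⟩ := by
      refine congrArg (Turing.TM2.Cfg.mk _ none) ?_
      funext k
      cases k with
      | rt => exact List.map_id w
      | _ => rfl
    erw [h2, h1]
    refine congrArg some (congrArg (Turing.TM2.Cfg.mk none none) ?_)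
    funext k
    cases k with
    | out => exact (List.map_id (eb (f w))).symm
    | _ => rfl
  · have h : ((Computability.encodingList Bool).encode w).length = w.length := rfl
    rw [h, Polynomial.eval_add, Polynomial.eval_one]
    exact (add_comm 1 (t w)).le.trans (Nat.succ_le_succ (ht w))

end CounterProg

/-! ### Running times -/

namespace CounterProg

variable {Γ : Type}

/-- The program `p`, started in `s`, stops in `s'` after at most `T` steps. -/
def Runs (p : CounterProg Γ) (s : CounterStore Γ) (T : ℕ) (s' : CounterStore Γ) : Prop :=
  ∃ t ≤ T, Exec p s t s'

namespace Runs

theorem skip (s : CounterStore Γ) (T : ℕ) : Runs .skip s T s := ⟨0, T.zero_le, .skip s⟩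

theorem op (o : CounterOp Γ) (s : CounterStore Γ) : Runs (.op o) s 1 (o.run s) := ⟨1, le_rfl, .op o s⟩

theorem seq {p q : CounterProg Γ} {s s' s'' : CounterStore Γ} {T T' : ℕ} (h : Runs p s T s')
    (h' : Runs q s' T' s'') : Runs (.seq p q) s (T + T') s'' := by
  obtain ⟨t, ht, h⟩ := h
  obtain ⟨t', ht', h'⟩ := h'
  exact ⟨t + t', add_le_add ht ht', h.seq h'⟩

theorem mono {p : CounterProg Γ} {s s' : CounterStore Γ} {T T' : ℕ} (h : Runs p s T s')
    (hT : T ≤ T') : Runs p s T' s' := by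
  obtain ⟨t, ht, h⟩ := h
  exact ⟨t, ht.trans hT, h⟩

theorem iteT {b : CounterTest} {p q : CounterProg Γ} {s s' : CounterStore Γ} {T : ℕ}
    (hb : b.holds s = true) (h : Runs p s T s') : Runs (.ite b p q) s (1 + T) s' := by
  obtain ⟨t, ht, h⟩ := h
  exact ⟨1 + t, by omega, .iteT hb h⟩

theorem iteF {b : CounterTest} {p q : CounterProg Γ} {s s' : CounterStore Γ} {T : ℕ}
    (hb : b.holds s = false) (h : Runs q s T s') : Runs (.ite b p q) s (1 + T) s' := by
  obtain ⟨t, ht, h⟩ := h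
  exact ⟨1 + t, by omega, .iteF hb h⟩

/-- A loop that passes through the states `σ c, …, σ 0`. -/
theorem while_of_forall {b : CounterTest} {p : CounterProg Γ} {T : ℕ} (σ : ℕ → CounterStore Γ)
    (c : ℕ) (h0 : b.holds (σ 0) = false) (h1 : ∀ j < c, b.holds (σ (j + 1)) = true)
    (hp : ∀ j < c, Runs p (σ (j + 1)) T (σ j)) :
    Runs (.while b p) (σ c) (c * (T + 1) + 1) (σ 0) := by
  induction c with
  | zero => exact ⟨1, by omega, .whileF h0⟩
  | succ c ih =>
    obtain ⟨t, ht, h⟩ := ih (fun j hj => h1 j (by omega)) (fun j hj => hp j (by omega))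
    obtain ⟨t', ht', h'⟩ := hp c (by omega)
    refine ⟨1 + t' + t, ?_, .whileT (h1 c (by omega)) h' h⟩
    rw [Nat.succ_mul]
    omega

end Runs

/-- A loop that counts the counter `r` down. -/
def countdown (r : ℕ) (p : CounterProg Γ) : CounterProg Γ := .while (.pos r) (.seq (.op (.dec r)) p)

/-- The decrement comes before the body, so the body sees the values `c - 1, …, 0`. Each round costs
`T` plus one step for the test and one for the decrement. -/
theorem Runs.countdown {r : ℕ} {p : CounterProg Γ} {T : ℕ} (σ : ℕ → CounterStore Γ) (c : ℕ)
    (hr : ∀ j ≤ c, (σ j).reg r = j)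
    (hp : ∀ j < c, Runs p ((CounterOp.dec r).run (σ (j + 1))) T (σ j)) :
    Runs (CounterProg.countdown r p) (σ c) (c * (T + 2) + 1) (σ 0) := by
  have := Runs.while_of_forall (b := .pos r) (p := .seq (.op (.dec r)) p) (T := 1 + T) σ c
    (by simp [CounterTest.holds, hr 0 (Nat.zero_le _)])
    (fun j hj => by simp [CounterTest.holds, hr (j + 1) hj])
    (fun j hj => (Runs.op _ _).seq (hp j hj))
  exact this.mono (by rw [show 1 + T + 1 = T + 2 by omega])

/-- The program that moves to the beginning of the input. -/
def rewind : CounterProg Γ := .while .left (.op .left)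

theorem Runs.rewind (s : CounterStore Γ) :
    Runs CounterProg.rewind s (s.lt.length * 2 + 1) { s with rt := s.lt.reverse ++ s.rt, lt := [] } := by
  obtain ⟨reg, rt, lt, out⟩ := s
  induction lt generalizing rt with
  | nil => exact ⟨1, by simp, .whileF rfl⟩
  | cons b lt ih =>
    obtain ⟨t, ht, h⟩ := ih (b :: rt)
    refine ⟨1 + 1 + t, ?_, .whileT rfl (.op _ _) ?_⟩
    · simp only [List.length_cons] at ht ⊢
      omega
    · exact (show (lt.reverse ++ b :: rt) = (b :: lt).reverse ++ rt by simp) ▸ h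

end CounterProg

/-! ### Functions that are definable in polynomial time -/

open CounterProg

/-- The environment `v` with a new variable in front. -/
def pushVar (i : ℕ) (v : ℕ → ℕ) : ℕ → ℕ
  | 0 => i
  | j + 1 => v j

@[simp] theorem pushVar_zero (i : ℕ) (v : ℕ → ℕ) : pushVar i v 0 = i := rfl

@[simp] theorem pushVar_succ (i : ℕ) (v : ℕ → ℕ) (j : ℕ) : pushVar i v (j + 1) = v j := rfl

/-- `F`, a function of the input word and of variables with values in the natural numbers, is
polynomially bounded, and there are counter programs that add `F` to a counter in polynomial
time. -/
def PolyDef (F : List Bool → (ℕ → ℕ) → ℕ) : Prop :=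
  (∃ P : Polynomial ℕ, ∀ w v N, w.length ≤ N → (∀ i, v i ≤ N) → F w v ≤ P.eval N) ∧
  -- `ρ` places the variables in registers below `n`. The registers from `n` on are scratch space,
  -- zero before and after the run, and `a` is an accumulator that holds no variable.
  ∀ (Γ : Type) (ρ : ℕ → ℕ) (n a : ℕ), (∀ i, ρ i < n) → a < n → (∀ i, ρ i ≠ a) →
    ∃ (p : CounterProg Γ) (P : Polynomial ℕ), ∀ (s : CounterStore Γ) (N : ℕ), s.lt = [] →
      (∀ r, n ≤ r → s.reg r = 0) → s.rt.length ≤ N → (∀ i, s.reg (ρ i) ≤ N) →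
      Runs p s (P.eval N) { s with reg := update s.reg a (s.reg a + F s.rt (s.reg ∘ ρ)) }

namespace PolyDef

variable {F G H : List Bool → (ℕ → ℕ) → ℕ}

theorem congr (hF : PolyDef F) (h : ∀ w v, F w v = G w v) : PolyDef G := by
  have : F = G := by funext w v; exact h w v
  exact this ▸ hF

theorem rename (hF : PolyDef F) (f : ℕ → ℕ) : PolyDef fun w v => F w (v ∘ f) := by
  obtain ⟨⟨P, hP⟩, h⟩ := hF
  refine ⟨⟨P, fun w v N hw hv => hP _ _ _ hw fun i => hv _⟩, fun Γ ρ n a hρ ha hne => ?_⟩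
  obtain ⟨p, Q, hp⟩ := h Γ (ρ ∘ f) n a (fun i => hρ _) ha fun i => hne _
  exact ⟨p, Q, fun s N h1 h2 h3 h4 => hp s N h1 h2 h3 fun i => h4 _⟩

theorem shift (hF : PolyDef F) : PolyDef fun w v => F w (v ∘ Nat.succ) := hF.rename _

theorem zero : PolyDef fun _ _ => 0 :=
  ⟨⟨0, fun _ _ _ _ _ => by simp⟩, fun Γ ρ n a _ _ _ => ⟨.skip, 0, fun s N _ _ _ _ => by
    simpa using Runs.skip s 0⟩⟩

theorem one : PolyDef fun _ _ => 1 :=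
  ⟨⟨1, fun _ _ _ _ _ => by simp⟩, fun Γ ρ n a _ _ _ => ⟨.op (.inc a), 1, fun s N _ _ _ _ => by
    simpa [CounterOp.run] using Runs.op (.inc a) s⟩⟩

theorem add (hF : PolyDef F) (hG : PolyDef G) : PolyDef fun w v => F w v + G w v := by
  obtain ⟨⟨P, hP⟩, hF⟩ := hF
  obtain ⟨⟨Q, hQ⟩, hG⟩ := hG
  refine ⟨⟨P + Q, fun w v N hw hv => ?_⟩, fun Γ ρ n a hρ ha hne => ?_⟩
  · rw [Polynomial.eval_add]
    exact add_le_add (hP w v N hw hv) (hQ w v N hw hv)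
  · obtain ⟨p, P', hp⟩ := hF Γ ρ n a hρ ha hne
    obtain ⟨q, Q', hq⟩ := hG Γ ρ n a hρ ha hne
    refine ⟨.seq p q, P' + Q', fun s N h1 h2 h3 h4 => ?_⟩
    rw [Polynomial.eval_add]
    have e : update s.reg a (s.reg a + F s.rt (s.reg ∘ ρ)) ∘ ρ = s.reg ∘ ρ := by
      funext i
      simp [hne i]
    have := hq { s with reg := update s.reg a (s.reg a + F s.rt (s.reg ∘ ρ)) } N h1
      (fun r hr => by simpa [show r ≠ a by omega] using h2 r hr) h3
      (fun i => by simpa [hne i] using h4 i)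
    refine ((hp s N h1 h2 h3 h4).seq this).mono le_rfl |> fun h => ?_
    simpa [e, add_assoc] using h

theorem const : ∀ c : ℕ, PolyDef fun _ _ => c
  | 0 => zero
  | c + 1 => (const c).add one

theorem var (i : ℕ) : PolyDef fun _ v => v i := by
  refine ⟨⟨Polynomial.X, fun w v N hw hv => by simpa using hv i⟩, fun Γ ρ n a hρ ha hne => ?_⟩
  -- Reading a counter destroys it, so its value is also poured into the scratch register `n`, from
  -- which it is then restored.
  refine ⟨.seq (countdown (ρ i) (.seq (.op (.inc n)) (.op (.inc a))))
    (countdown n (.op (.inc (ρ i)))),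
    Polynomial.X * Polynomial.C 4 + 1 + (Polynomial.X * Polynomial.C 3 + 1),
    fun s N h1 h2 h3 h4 => ?_⟩
  have hi := hρ i
  have hia := hne i
  have hc : s.reg n = 0 := h2 n le_rfl
  set c := s.reg (ρ i) with hcdef
  have hcN : c ≤ N := h4 i
  let σ : ℕ → CounterStore Γ := fun j =>
    { s with reg := update (update (update s.reg (ρ i) j) n (c - j)) a (s.reg a + (c - j)) }
  have hσ : σ c = s := by
    simp only [σ, Nat.sub_self, add_zero, hcdef, update_eq_self]
    rw [← hc, update_eq_self, update_eq_self]
  let τ : ℕ → CounterStore Γ := fun j =>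
    { s with reg := update (update (update s.reg (ρ i) (c - j)) n j) a (s.reg a + c) }
  have hτ : τ c = σ 0 := by simp [σ, τ]
  have r1 := Runs.countdown (r := ρ i) (p := .seq (.op (.inc n)) (.op (.inc a))) (T := 1 + 1) σ c
    (fun j _ => by simp [σ, hia, show ρ i ≠ n by omega])
    (fun j hj => by
      convert (Runs.op _ _).seq (Runs.op _ _) using 1
      simp only [CounterOp.run, σ, CounterStore.mk.injEq, and_true]
      funext r
      simp only [update_apply]
      split_ifs <;> omega)
  have r2 := Runs.countdown (r := n) (p := .op (.inc (ρ i))) (T := 1) τ c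
    (fun j _ => by simp [τ, show n ≠ a by omega])
    (fun j hj => by
      convert (Runs.op _ _) using 1
      simp only [CounterOp.run, τ, CounterStore.mk.injEq, and_true]
      funext r
      simp only [update_apply]
      split_ifs <;> omega)
  rw [hσ] at r1
  rw [hτ] at r2
  have r := r1.seq r2
  have e : τ 0 = { s with reg := update s.reg a (s.reg a + (s.reg ∘ ρ) i) } := by
    simp only [τ, Nat.sub_zero, hcdef, update_eq_self, comp_apply]
    rw [← hc, update_eq_self]
  rw [e] at r
  refine r.mono ?_
  simp only [Polynomial.eval_add, Polynomial.eval_mul, Polynomial.eval_X, Polynomial.eval_C,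
    Polynomial.eval_one]
  omega

/-- Both values are computed in scratch registers. Counting the second down while decrementing the
first leaves the truncated difference, which is then poured into the accumulator. -/
theorem sub (hF : PolyDef F) (hG : PolyDef G) : PolyDef fun w v => F w v - G w v := by
  obtain ⟨⟨P, hP⟩, hF⟩ := hF
  obtain ⟨⟨Q, hQ⟩, hG⟩ := hG
  refine ⟨⟨P, fun w v N hw hv => (Nat.sub_le _ _).trans (hP w v N hw hv)⟩,
    fun Γ ρ n a hρ ha hne => ?_⟩
  have hρn : ∀ i, ρ i ≠ n := fun i => (hρ i).ne
  have hρn1 : ∀ i, ρ i ≠ n + 1 := fun i => by have := hρ i; omega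
  obtain ⟨p, P', hp⟩ := hF Γ ρ (n + 2) n (fun i => by have := hρ i; omega) (by omega) hρn
  obtain ⟨q, Q', hq⟩ := hG Γ ρ (n + 2) (n + 1) (fun i => by have := hρ i; omega) (by omega) hρn1
  refine ⟨.seq (.seq p q) (.seq (countdown (n + 1) (.op (.dec n))) (countdown n (.op (.inc a)))),
    P' + Q' + (Q * Polynomial.C 3 + 1 + (P * Polynomial.C 3 + 1)), fun s N h1 h2 h3 h4 => ?_⟩
  set f := F s.rt (s.reg ∘ ρ) with hf
  set g := G s.rt (s.reg ∘ ρ) with hg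
  have hn : s.reg n = 0 := h2 n le_rfl
  have hn1 : s.reg (n + 1) = 0 := h2 (n + 1) (by omega)
  have rp := hp s N h1 (fun r hr => h2 r (by omega)) h3 h4
  rw [← hf, hn, zero_add] at rp
  have e : update s.reg n f ∘ ρ = s.reg ∘ ρ := by
    funext i
    simp [hρn i]
  have rq := hq { s with reg := update s.reg n f } N h1
      (fun r hr => by simpa [show r ≠ n by omega] using h2 r (by omega)) h3
      (fun i => by simpa [hρn i] using h4 i)
  simp only [e, ← hg] at rq
  rw [update_of_ne (by omega), hn1, zero_add] at rq
  let σ : ℕ → CounterStore Γ := fun j =>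
    { s with reg := update (update s.reg n (f - (g - j))) (n + 1) j }
  let τ : ℕ → CounterStore Γ := fun j =>
    { s with reg := update (update s.reg n j) a (s.reg a + (f - g - j)) }
  have r1 := Runs.countdown (r := n + 1) (p := .op (.dec n)) (T := 1) σ g
    (fun j _ => by simp [σ])
    (fun j hj => by
      convert (Runs.op _ _) using 1
      simp only [CounterOp.run, σ, CounterStore.mk.injEq, and_true]
      funext r
      simp only [update_apply]
      split_ifs <;> omega)
  have r2 := Runs.countdown (r := n) (p := .op (.inc a)) (T := 1) τ (f - g)
    (fun j _ => by simp [τ, show n ≠ a by omega])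
    (fun j hj => by
      convert (Runs.op _ _) using 1
      simp only [CounterOp.run, τ, CounterStore.mk.injEq, and_true]
      funext r
      simp only [update_apply]
      split_ifs <;> omega)
  have e1 : σ g = { s with reg := update (update s.reg n f) (n + 1) g } := by simp [σ]
  have e2 : σ 0 = τ (f - g) := by
    simp only [σ, τ, CounterStore.mk.injEq, and_true]
    funext r
    rcases eq_or_ne r (n + 1) with rfl | h
    · simp [hn1, show n + 1 ≠ a by omega]
    · rcases eq_or_ne r a with rfl | h'
      · simp [h, ha.ne]
      · simp [h, h']
  have e3 : τ 0 = { s with reg := update s.reg a (s.reg a + (f - g)) } := by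
    simp only [τ, Nat.sub_zero]
    rw [← hn, update_eq_self]
  rw [e1, e2] at r1
  rw [e3] at r2
  refine ((rp.seq rq).seq (r1.seq r2)).mono ?_
  have b1 := hP s.rt (s.reg ∘ ρ) N h3 h4
  have b2 := hQ s.rt (s.reg ∘ ρ) N h3 h4
  simp only [Polynomial.eval_add, Polynomial.eval_mul, Polynomial.eval_C, Polynomial.eval_one]
  omega

/-- The loop counter `n` itself serves as the summation variable and runs downwards, so at value `j`
the terms with indices in `Finset.Ico j f` have been added. Its values are bounded by those of `F`,
so each round is polynomial in `N + P.eval N`. -/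
theorem sum (hF : PolyDef F) {G : List Bool → (ℕ → ℕ) → ℕ → ℕ}
    (hG : PolyDef fun w v => G w (v ∘ Nat.succ) (v 0)) :
    PolyDef fun w v => ∑ i ∈ Finset.range (F w v), G w v i := by
  obtain ⟨⟨P, hP⟩, hF⟩ := hF
  obtain ⟨⟨Q, hQ⟩, hG⟩ := hG
  have hcons : ∀ (w : List Bool) (v : ℕ → ℕ) (N i : ℕ), w.length ≤ N → (∀ i, v i ≤ N) → i ≤ F w v →
      w.length ≤ N + P.eval N ∧ ∀ j, pushVar i v j ≤ N + P.eval N := by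
    intro w v N i hw hv hi
    refine ⟨by omega, fun j => ?_⟩
    have := hP w v N hw hv
    cases j with
    | zero => simp only [pushVar_zero]; omega
    | succ j => have := hv j; simp only [pushVar_succ]; omega
  refine ⟨⟨P * Q.comp (Polynomial.X + P), fun w v N hw hv => ?_⟩, fun Γ ρ n a hρ ha hne => ?_⟩
  · simp only [Polynomial.eval_mul, Polynomial.eval_comp, Polynomial.eval_add, Polynomial.eval_X]
    calc ∑ i ∈ Finset.range (F w v), G w v i
        ≤ ∑ i ∈ Finset.range (F w v), Q.eval (N + P.eval N) := by
          refine Finset.sum_le_sum fun i hi => ?_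
          obtain ⟨h1, h2⟩ := hcons w v N i hw hv (Finset.mem_range.1 hi).le
          exact hQ w (pushVar i v) _ h1 h2
      _ ≤ _ := by
          simp only [Finset.sum_const, Finset.card_range, smul_eq_mul]
          exact Nat.mul_le_mul_right _ (hP w v N hw hv)
  · have hρn : ∀ i, ρ i ≠ n := fun i => (hρ i).ne
    obtain ⟨p, P', hp⟩ := hF Γ ρ (n + 1) n (fun i => by have := hρ i; omega) (by omega) hρn
    obtain ⟨q, Q', hq⟩ := hG Γ (pushVar n ρ) (n + 1) a
      (fun i => by cases i with
        | zero => simp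
        | succ i => have := hρ i; simp only [pushVar_succ]; omega) (by omega)
      (fun i => by cases i with
        | zero => simp only [pushVar_zero]; omega
        | succ i => exact hne i)
    refine ⟨.seq p (countdown n q),
      P' + (P * (Q'.comp (Polynomial.X + P) + Polynomial.C 2) + 1), fun s N h1 h2 h3 h4 => ?_⟩
    have hn : s.reg n = 0 := h2 n le_rfl
    set f := F s.rt (s.reg ∘ ρ) with hf
    have rp := hp s N h1 (fun r hr => h2 r (by omega)) h3 h4
    rw [← hf, hn, zero_add] at rp
    let σ : ℕ → CounterStore Γ := fun j => { s with
      reg := update (update s.reg n j) a (s.reg a + ∑ i ∈ Finset.Ico j f, G s.rt (s.reg ∘ ρ) i) }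
    have e1 : σ f = { s with reg := update s.reg n f } := by
      simp only [σ, Finset.Ico_self, Finset.sum_empty, add_zero, CounterStore.mk.injEq, and_true]
      funext r
      rcases eq_or_ne r a with rfl | h'
      · simp [ha.ne]
      · simp [h']
    have e2 : σ 0 = { s with
        reg := update s.reg a (s.reg a + ∑ i ∈ Finset.range f, G s.rt (s.reg ∘ ρ) i) } := by
      simp only [σ, ← hn, update_eq_self]
      rw [hn, Nat.Ico_zero_eq_range]
    have r1 := Runs.countdown (r := n) (p := q) (T := Q'.eval (N + P.eval N)) σ f
      (fun j _ => by simp [σ, show n ≠ a by omega])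
      (fun j hj => by
        have e : ((CounterOp.dec n).run (σ (j + 1))).reg ∘ pushVar n ρ = pushVar j (s.reg ∘ ρ) := by
          funext i
          cases i with
          | zero => simp [CounterOp.run, σ, show n ≠ a by omega]
          | succ i => simp [CounterOp.run, σ, hρn i, hne i]
        obtain ⟨b1, b2⟩ := hcons s.rt (s.reg ∘ ρ) N j h3 h4 hj.le
        have := hq ((CounterOp.dec n).run (σ (j + 1))) (N + P.eval N) h1
          (fun r hr => by
            simpa [CounterOp.run, σ, show r ≠ a by omega, show r ≠ n by omega] using
              h2 r (by omega)) b1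
          (fun i => (congrFun e i).trans_le (b2 i))
        rw [e] at this
        convert this using 1
        simp only [CounterOp.run, σ, CounterStore.mk.injEq, and_true]
        rw [Finset.sum_eq_sum_Ico_succ_bot hj]
        funext r
        have : pushVar j (s.reg ∘ ρ) ∘ Nat.succ = s.reg ∘ ρ := rfl
        simp only [update_apply, pushVar_zero, this]
        split_ifs <;> omega)
    rw [e1, e2] at r1
    refine (rp.seq r1).mono ?_
    simp only [Polynomial.eval_add, Polynomial.eval_mul, Polynomial.eval_C, Polynomial.eval_one,
      Polynomial.eval_comp, Polynomial.eval_X]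
    have := Nat.mul_le_mul_right (Q'.eval (N + P.eval N) + 2) (hP s.rt (s.reg ∘ ρ) N h3 h4)
    rw [← hf] at this
    omega

theorem length : PolyDef fun w _ => w.length := by
  refine ⟨⟨Polynomial.X, fun w v N hw hv => by simpa using hw⟩, fun Γ ρ n a hρ ha hne => ?_⟩
  refine ⟨.seq (.while .right (.seq (.op .right) (.op (.inc a)))) rewind,
    Polynomial.X * Polynomial.C 3 + 1 + (Polynomial.X * Polynomial.C 2 + 1),
    fun s N h1 h2 h3 h4 => ?_⟩
  obtain ⟨reg, w, lt, out⟩ := s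
  dsimp only at *
  subst h1
  let σ : ℕ → CounterStore Γ := fun j =>
    ⟨update reg a (reg a + (w.length - j)), w.drop (w.length - j), (w.take (w.length - j)).reverse, out⟩
  have r1 := Runs.while_of_forall (b := .right) (p := .seq (.op .right) (.op (.inc a)))
    (T := 1 + 1) σ w.length (by simp [CounterTest.holds, σ])
    (fun j hj => by simp [CounterTest.holds, σ]; omega)
    (fun j hj => by
      convert (Runs.op _ _).seq (Runs.op _ _) using 1
      simp only [CounterOp.run, σ, CounterStore.mk.injEq, and_true, List.tail_drop]
      rw [show w.length - j = w.length - (j + 1) + 1 by omega]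
      refine ⟨?_, rfl, ?_⟩
      · simp [add_assoc]
      · rw [List.take_add_one, List.reverse_append, List.head?_drop]
        cases w[w.length - (j + 1)]? <;> rfl)
  have r2 := Runs.rewind (σ 0)
  have e1 : σ w.length = ⟨reg, w, [], out⟩ := by simp [σ]
  rw [e1] at r1
  have e2 : ({ σ 0 with rt := (σ 0).lt.reverse ++ (σ 0).rt, lt := [] } : CounterStore Γ) =
      ⟨update reg a (reg a + w.length), w, [], out⟩ := by simp [σ]
  rw [e2] at r2
  refine (r1.seq r2).mono ?_
  · simp only [Polynomial.eval_add, Polynomial.eval_mul, Polynomial.eval_C, Polynomial.eval_one,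
      Polynomial.eval_X]
    simp only [σ, List.length_reverse, List.length_take]
    omega

/-- The reading position advances as often as the computed index says and is rewound after the test.
Moving right past the end has no effect and makes the test fail, in agreement with `w[F w v]? =
none`. -/
theorem inputBit (hF : PolyDef F) : PolyDef fun w v => if w[F w v]? = some true then 1 else 0 := by
  obtain ⟨⟨P, hP⟩, hF⟩ := hF
  refine ⟨⟨1, fun w v N hw hv => by dsimp only; split_ifs <;> simp⟩, fun Γ ρ n a hρ ha hne => ?_⟩
  have hρn : ∀ i, ρ i ≠ n := fun i => (hρ i).ne
  obtain ⟨p, P', hp⟩ := hF Γ ρ (n + 1) n (fun i => by have := hρ i; omega) (by omega) hρn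
  refine ⟨.seq p (.seq (countdown n (.op .right)) (.seq (.ite .one (.op (.inc a)) .skip) rewind)),
    P' + (P * Polynomial.C 3 + 1 + (1 + 1 + (Polynomial.X * Polynomial.C 2 + 1))),
    fun s N h1 h2 h3 h4 => ?_⟩
  have hn : s.reg n = 0 := h2 n le_rfl
  have rp := hp s N h1 (fun r hr => h2 r (by omega)) h3 h4
  have b1 := hP s.rt (s.reg ∘ ρ) N h3 h4
  set f := F s.rt (s.reg ∘ ρ) with hf
  rw [hn, zero_add] at rp
  obtain ⟨reg, w, lt, out⟩ := s
  dsimp only at *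
  subst h1
  let σ : ℕ → CounterStore Γ := fun j =>
    ⟨update reg n j, w.drop (f - j), (w.take (f - j)).reverse, out⟩
  have r1 := Runs.countdown (r := n) (p := .op .right) (T := 1) σ f
    (fun j _ => by simp [σ])
    (fun j hj => by
      convert (Runs.op _ _) using 1
      simp only [CounterOp.run, σ, CounterStore.mk.injEq, and_true, List.tail_drop]
      rw [show f - j = f - (j + 1) + 1 by omega]
      refine ⟨?_, rfl, ?_⟩
      · simp
      · rw [List.take_add_one, List.reverse_append, List.head?_drop]
        cases w[f - (j + 1)]? <;> rfl)
  have e1 : σ f = ⟨update reg n f, w, [], out⟩ := by simp [σ]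
  have e2 : σ 0 = ⟨reg, w.drop f, (w.take f).reverse, out⟩ := by
    have : update reg n 0 = reg := by rw [← hn, update_eq_self]
    simp [σ, this]
  rw [e1, e2] at r1
  have r2 : Runs (.ite .one (.op (.inc a)) .skip) ⟨reg, w.drop f, (w.take f).reverse, out⟩ (1 + 1)
      ⟨update reg a (reg a + if w[f]? = some true then 1 else 0), w.drop f,
        (w.take f).reverse, out⟩ := by
    by_cases h : w[f]? = some true
    · refine Runs.iteT (by simp [CounterTest.holds, h]) ?_
      simpa [h, CounterOp.run] using Runs.op (.inc a) _
    · refine Runs.iteF (by simpa [CounterTest.holds] using h) ?_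
      simpa [h] using Runs.skip _ _
  have r3 := Runs.rewind (Γ := Γ) ⟨update reg a (reg a + if w[f]? = some true then 1 else 0), w.drop f,
        (w.take f).reverse, out⟩
  simp only [List.reverse_reverse, List.take_append_drop] at r3
  refine (rp.seq (r1.seq (r2.seq r3))).mono ?_
  simp only [Polynomial.eval_add, Polynomial.eval_mul, Polynomial.eval_C, Polynomial.eval_one,
    Polynomial.eval_X, List.length_reverse, List.length_take]
  omega

end PolyDef

/-! ### Closure under arithmetic, predicates and case distinctions -/

open CounterProg

namespace PolyDef

variable {F G H : List Bool → (ℕ → ℕ) → ℕ}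

theorem mul (hF : PolyDef F) (hG : PolyDef G) : PolyDef fun w v => F w v * G w v :=
  (sum (G := fun w v _ => G w v) hF hG.shift).congr fun w v => by simp

theorem pow (hF : PolyDef F) : ∀ k : ℕ, PolyDef fun w v => F w v ^ k
  | 0 => one.congr fun _ _ => (pow_zero _).symm
  | k + 1 => ((pow hF k).mul hF).congr fun _ _ => (pow_succ _ _).symm

theorem polynomial (hF : PolyDef F) (P : Polynomial ℕ) : PolyDef fun w v => P.eval (F w v) := by
  induction P using Polynomial.induction_on' with
  | add p q hp hq => exact (hp.add hq).congr fun w v => by simp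
  | monomial n a => exact ((const a).mul (hF.pow n)).congr fun w v => by simp

end PolyDef

/-- A predicate that can be decided in polynomial time. -/
def PolyPred (p : List Bool → (ℕ → ℕ) → Prop) : Prop :=
  ∃ F, PolyDef F ∧ ∀ w v, p w v ↔ F w v ≠ 0

namespace PolyPred

variable {F G : List Bool → (ℕ → ℕ) → ℕ} {p q : List Bool → (ℕ → ℕ) → Prop}

theorem congr (hp : PolyPred p) (h : ∀ w v, p w v ↔ q w v) : PolyPred q := by
  obtain ⟨F, hF, hpF⟩ := hp
  exact ⟨F, hF, fun w v => (h w v).symm.trans (hpF w v)⟩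

theorem const (b : Prop) : PolyPred fun _ _ => b := by
  by_cases h : b
  · exact ⟨_, PolyDef.one, by simp [h]⟩
  · exact ⟨_, PolyDef.zero, by simp [h]⟩

theorem not (hp : PolyPred p) : PolyPred fun w v => ¬ p w v := by
  obtain ⟨F, hF, h⟩ := hp
  exact ⟨_, PolyDef.one.sub hF, fun w v => by simp only [h]; omega⟩

theorem and (hp : PolyPred p) (hq : PolyPred q) : PolyPred fun w v => p w v ∧ q w v := by
  obtain ⟨F, hF, h⟩ := hp
  obtain ⟨G, hG, h'⟩ := hq
  exact ⟨_, hF.mul hG, fun w v => by simp only [h, h']; exact mul_ne_zero_iff.symm⟩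

theorem or (hp : PolyPred p) (hq : PolyPred q) : PolyPred fun w v => p w v ∨ q w v := by
  obtain ⟨F, hF, h⟩ := hp
  obtain ⟨G, hG, h'⟩ := hq
  exact ⟨_, hF.add hG, fun w v => by simp only [h, h']; omega⟩

theorem lt (hF : PolyDef F) (hG : PolyDef G) : PolyPred fun w v => F w v < G w v :=
  ⟨_, hG.sub hF, fun w v => by omega⟩

theorem le (hF : PolyDef F) (hG : PolyDef G) : PolyPred fun w v => F w v ≤ G w v :=
  (lt hG hF).not.congr fun w v => by omega

theorem eq (hF : PolyDef F) (hG : PolyDef G) : PolyPred fun w v => F w v = G w v :=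
  ((le hF hG).and (le hG hF)).congr fun w v => by omega

theorem inputBit (hF : PolyDef F) : PolyPred fun w v => w[F w v]? = some true :=
  ⟨_, hF.inputBit, fun w v => by simp⟩

end PolyPred

namespace PolyDef

variable {F G : List Bool → (ℕ → ℕ) → ℕ} {p : List Bool → (ℕ → ℕ) → Prop}

theorem ite [∀ w v, Decidable (p w v)] (hp : PolyPred p) (hF : PolyDef F) (hG : PolyDef G) :
    PolyDef fun w v => if p w v then F w v else G w v := by
  obtain ⟨I, hI, h⟩ := hp
  -- Subtraction is truncated, so `1 - (1 - I)` and `1 - I` are the indicators of the two cases.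
  refine (((one.sub (one.sub hI)).mul hF).add ((one.sub hI).mul hG)).congr fun w v => ?_
  have := h w v
  split_ifs with hp
  · have h0 : 1 - I w v = 0 := by have := this.1 hp; omega
    simp [h0]
  · have h0 : I w v = 0 := by tauto
    simp [h0]

theorem bsum {c : ℕ} {H : ℕ → List Bool → (ℕ → ℕ) → ℕ} (hH : ∀ j < c, PolyDef (H j)) :
    PolyDef fun w v => ∑ j ∈ Finset.range c, H j w v := by
  induction c with
  | zero => exact zero.congr fun w v => by simp
  | succ c ih =>
    exact ((ih fun j hj => hH j (by omega)).add (hH c (by omega))).congr fun w v => by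
      rw [Finset.sum_range_succ]

/-- Definition by a case distinction with finitely many cases. -/
theorem cases {c : ℕ} (hF : PolyDef F) (hc : ∀ w v, F w v < c)
    {H : ℕ → List Bool → (ℕ → ℕ) → ℕ} (hH : ∀ j < c, PolyDef (H j)) :
    PolyDef fun w v => H (F w v) w v :=
  (bsum fun j hj => ite (.eq hF (const j)) (hH j hj) zero).congr fun w v => by
    simp [hc w v]

/-- Division becomes bounded counting: the quotient is the number of positive multiples of `d` up to
the dividend. For `d = 0` both sides follow the convention that the quotient is 0. -/
theorem divConst (hF : PolyDef F) (d : ℕ) : PolyDef fun w v => F w v / d := by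
  rcases d.eq_zero_or_pos with rfl | hd
  · exact zero.congr fun w v => by simp
  · refine (sum (G := fun w v i => if (i + 1) * d ≤ F w v then 1 else 0) hF
      (ite (.le (((var 0).add one).mul (const d)) hF.shift) one zero)).congr fun w v => ?_
    rw [← Finset.sum_filter, ← Finset.card_eq_sum_ones]
    have : (Finset.range (F w v)).filter (fun i => (i + 1) * d ≤ F w v) =
        Finset.range (F w v / d) := by
      ext i
      simp only [Finset.mem_filter, Finset.mem_range, ← Nat.le_div_iff_mul_le hd]
      have := Nat.div_le_self (F w v) d
      omega
    rw [this, Finset.card_range]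

theorem modConst (hF : PolyDef F) (d : ℕ) : PolyDef fun w v => F w v % d :=
  (hF.sub ((const d).mul (hF.divConst d))).congr fun w v => by
    have := Nat.div_add_mod (F w v) d
    omega

end PolyDef

theorem PolyPred.cases {F : List Bool → (ℕ → ℕ) → ℕ} {c : ℕ} (hF : PolyDef F)
    (hc : ∀ w v, F w v < c) {p : ℕ → List Bool → (ℕ → ℕ) → Prop} (hp : ∀ j < c, PolyPred (p j)) :
    PolyPred fun w v => p (F w v) w v := by
  classical
  refine ⟨_, PolyDef.cases (H := fun j w v => if p j w v then 1 else 0) hF hc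
    fun j hj => .ite (hp j hj) .one .zero, fun w v => by simp⟩

/-! ### Words that are definable in polynomial time -/

/-- There are counter programs that write the word `L`, a function of the input word and of
variables with values in the natural numbers, in polynomial time. -/
def PolyWord {Γ : Type} (L : List Bool → (ℕ → ℕ) → List Γ) : Prop :=
  ∀ (ρ : ℕ → ℕ) (n : ℕ), (∀ i, ρ i < n) →
    ∃ (p : CounterProg Γ) (P : Polynomial ℕ), ∀ (s : CounterStore Γ) (N : ℕ), s.lt = [] →
      (∀ r, n ≤ r → s.reg r = 0) → s.rt.length ≤ N → (∀ i, s.reg (ρ i) ≤ N) →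
      Runs p s (P.eval N) { s with out := L s.rt (s.reg ∘ ρ) ++ s.out }

namespace PolyWord

variable {Γ : Type} {L L' : List Bool → (ℕ → ℕ) → List Γ} {F : List Bool → (ℕ → ℕ) → ℕ}

theorem congr (hL : PolyWord L) (h : ∀ w v, L w v = L' w v) : PolyWord L' := by
  have : L = L' := by funext w v; exact h w v
  exact this ▸ hL

theorem nil : PolyWord fun _ _ => ([] : List Γ) := fun ρ n _ =>
  ⟨.skip, 0, fun s N _ _ _ _ => by simpa using Runs.skip s 0⟩

theorem singleton (c : Γ) : PolyWord fun _ _ => [c] := fun ρ n _ =>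
  ⟨.op (.emit c), 1, fun s N _ _ _ _ => by simpa [CounterOp.run] using Runs.op (.emit c) s⟩

theorem append (hL : PolyWord L) (hL' : PolyWord L') : PolyWord fun w v => L w v ++ L' w v := by
  intro ρ n hρ
  obtain ⟨p, P, hp⟩ := hL ρ n hρ
  obtain ⟨q, Q, hq⟩ := hL' ρ n hρ
  -- The output grows at its front, so the second word is written first.
  refine ⟨.seq q p, Q + P, fun s N h1 h2 h3 h4 => ?_⟩
  rw [Polynomial.eval_add]
  simpa using (hq s N h1 h2 h3 h4).seq (hp { s with out := L' s.rt (s.reg ∘ ρ) ++ s.out } N h1 h2 h3 h4)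

theorem ite {p : List Bool → (ℕ → ℕ) → Prop} [∀ w v, Decidable (p w v)] (hp : PolyPred p)
    (hL : PolyWord L) (hL' : PolyWord L') :
    PolyWord fun w v => if p w v then L w v else L' w v := by
  intro ρ n hρ
  obtain ⟨I, hI, hIp⟩ := hp
  have hρn : ∀ i, ρ i ≠ n := fun i => (hρ i).ne
  have hD : PolyDef fun w v => 1 - (1 - I w v) := PolyDef.one.sub (PolyDef.one.sub hI)
  obtain ⟨r, R, hr⟩ := hD.2 Γ ρ (n + 1) n (fun i => by have := hρ i; omega) (by omega) hρn
  obtain ⟨p', P, hp⟩ := hL ρ n hρ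
  obtain ⟨q, Q, hq⟩ := hL' ρ n hρ
  refine ⟨.seq r (.ite (.pos n) (.seq (.op (.dec n)) p') q), R + (1 + (1 + P) + Q),
    fun s N h1 h2 h3 h4 => ?_⟩
  simp only [Polynomial.eval_add, Polynomial.eval_one]
  have hn : s.reg n = 0 := h2 n le_rfl
  have h := hr s N h1 (fun r hr => h2 r (by omega)) h3 h4
  have hI' := hIp s.rt (s.reg ∘ ρ)
  refine h.seq ?_
  by_cases hpw : p s.rt (s.reg ∘ ρ)
  · have e : 1 - (1 - I s.rt (s.reg ∘ ρ)) = 1 := by have := hI'.1 hpw; omega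
    simp only [hpw, if_true, e, hn]
    refine (Runs.iteT (T := 1 + P.eval N) (by simp [CounterTest.holds]) ?_).mono (by omega)
    refine (Runs.op _ _).seq ?_
    have : (CounterOp.dec n).run { s with reg := update s.reg n (0 + 1) } = s := by
      simp only [CounterOp.run, update_self, update_idem]
      rw [show 0 + 1 - 1 = s.reg n by omega, update_eq_self]
    rw [this]
    exact hp s N h1 h2 h3 h4
  · have e : 1 - (1 - I s.rt (s.reg ∘ ρ)) = 0 := by have := mt hI'.2 hpw; omega
    simp only [hpw, if_false, e, hn]
    rw [show (0 + 0) = s.reg n by omega, update_eq_self]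
    exact (Runs.iteF (by simp [CounterTest.holds, hn]) (hq s N h1 h2 h3 h4)).mono (by omega)

theorem flatMap_range (hF : PolyDef F) {L : List Bool → (ℕ → ℕ) → ℕ → List Γ}
    (hL : PolyWord fun w v => L w (v ∘ Nat.succ) (v 0)) :
    PolyWord fun w v => (List.range (F w v)).flatMap (L w v) := by
  obtain ⟨⟨P, hP⟩, hF⟩ := hF
  intro ρ n hρ
  have hρn : ∀ i, ρ i ≠ n := fun i => (hρ i).ne
  obtain ⟨p, P', hp⟩ := hF Γ ρ (n + 1) n (fun i => by have := hρ i; omega) (by omega) hρn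
  obtain ⟨q, Q', hq⟩ := hL (pushVar n ρ) (n + 1)
    (fun i => by cases i with
      | zero => simp
      | succ i => have := hρ i; simp only [pushVar_succ]; omega)
  refine ⟨.seq p (countdown n q),
    P' + (P * (Q'.comp (Polynomial.X + P) + Polynomial.C 2) + 1), fun s N h1 h2 h3 h4 => ?_⟩
  have hn : s.reg n = 0 := h2 n le_rfl
  have hfP := hP s.rt (s.reg ∘ ρ) N h3 h4
  set f := F s.rt (s.reg ∘ ρ) with hf
  have rp := hp s N h1 (fun r hr => h2 r (by omega)) h3 h4
  rw [← hf, hn, zero_add] at rp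
  -- Counting down emits the last block first, which is the right order for an output growing at its
  -- front; at value `j` the blocks from `j` on are present.
  let σ : ℕ → CounterStore Γ := fun j => { s with
    reg := update s.reg n j
    out := ((List.range f).drop j).flatMap (L s.rt (s.reg ∘ ρ)) ++ s.out }
  have e1 : σ f = { s with reg := update s.reg n f } := by
    simp only [σ]
    rw [List.drop_of_length_le (by simp)]
    rfl
  have e2 : σ 0 = { s with
      out := (List.range f).flatMap (L s.rt (s.reg ∘ ρ)) ++ s.out } := by
    simp only [σ, ← hn, update_eq_self]
    rw [hn, List.drop_zero]
  have r1 := Runs.countdown (r := n) (p := q) (T := Q'.eval (N + P.eval N)) σ f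
    (fun j _ => by simp [σ])
    (fun j hj => by
      have e : ((CounterOp.dec n).run (σ (j + 1))).reg ∘ pushVar n ρ = pushVar j (s.reg ∘ ρ) := by
        funext i
        cases i with
        | zero => simp [CounterOp.run, σ]
        | succ i => simp [CounterOp.run, σ, hρn i]
      have := hq ((CounterOp.dec n).run (σ (j + 1))) (N + P.eval N) h1
        (fun r hr => by
          simpa [CounterOp.run, σ, show r ≠ n by omega] using h2 r (by omega))
        (Nat.le_add_right_of_le h3)
        (fun i => (congrFun e i).trans_le (by
          cases i with
          | zero => simp only [pushVar_zero]; omega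
          | succ i => have := h4 i; simp only [pushVar_succ, comp_apply]; omega))
      rw [e] at this
      convert this using 1
      simp only [CounterOp.run, σ, CounterStore.mk.injEq]
      refine ⟨by simp, trivial, trivial, ?_⟩
      rw [List.drop_eq_getElem_cons (by simpa using hj), List.flatMap_cons, List.getElem_range,
        List.append_assoc]
      rfl)
  rw [e1, e2] at r1
  refine (rp.seq r1).mono ?_
  simp only [Polynomial.eval_add, Polynomial.eval_mul, Polynomial.eval_C, Polynomial.eval_one,
    Polynomial.eval_comp, Polynomial.eval_X]
  have := Nat.mul_le_mul_right (Q'.eval (N + P.eval N) + 2) hfP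
  omega

theorem replicate (hF : PolyDef F) (c : Γ) : PolyWord fun w v => List.replicate (F w v) c :=
  (flatMap_range hF (L := fun _ _ _ => [c]) (singleton c)).congr fun w v => by
    induction F w v with
    | zero => rfl
    | succ n ih => rw [List.range_succ, List.flatMap_append, ih, List.replicate_succ']; rfl

theorem flatMap_list {α : Type} (l : List α) {L : α → List Bool → (ℕ → ℕ) → List Γ}
    (hL : ∀ a ∈ l, PolyWord (L a)) : PolyWord fun w v => l.flatMap fun a => L a w v := by
  induction l with
  | nil => exact nil
  | cons a l ih =>
    exact ((hL a (by simp)).append (ih fun b hb => hL b (by simp [hb]))).congr fun w v => by simp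

/-- The word that lists the symbols for all tuples with a given sum. -/
theorem flatMap_antidiagonalTuple : ∀ (k : ℕ) {F : List Bool → (ℕ → ℕ) → ℕ} (_ : PolyDef F)
    {L : List Bool → (ℕ → ℕ) → (Fin k → ℕ) → List Γ}
    (_ : PolyWord fun w v => L w (fun i => v (i + k)) fun j => v (k - 1 - j)),
    PolyWord fun w v => (List.Nat.antidiagonalTuple k (F w v)).flatMap (L w v)
  | 0, F, hF, L, hL => by
    refine (ite (.eq hF .zero) hL nil).congr fun w v => ?_
    rcases F w v with _ | m
    · simp only [List.Nat.antidiagonalTuple_zero_zero, List.flatMap_singleton, if_true]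
      exact congrArg _ (Subsingleton.elim _ _)
    · simp
  | k + 1, F, hF, L, hL => by
    -- The first entry becomes a loop variable and the rest of the tuple is treated recursively.
    -- Each later entry is pushed in front of the environment, so entry `j` ends up as variable `k -
    -- 1 - j`.
    refine (flatMap_range (hF.add .one) (L := fun w v i =>
      (List.Nat.antidiagonalTuple k (F w v - i)).flatMap fun x => L w v (Fin.cons i x))
      (flatMap_antidiagonalTuple k (L := fun w v x => L w (v ∘ Nat.succ) (Fin.cons (v 0) x))
        (hF.shift.sub (.var 0)) (hL.congr fun w v => ?_))).congr fun w v => ?_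
    · refine congrArg₂ (L w) (funext fun i => congrArg v (by omega)) (funext fun j => ?_)
      refine Fin.cases ?_ (fun j => ?_) j
      · simp
      · simp only [Fin.val_succ, Fin.cons_succ]
        congr 1
        omega
    · simp only [List.Nat.antidiagonalTuple, List.Nat.antidiagonal, List.flatMap_map,
        List.flatMap_assoc]

/-- A function whose values are words that are definable in polynomial time is computable in
polynomial time. -/
theorem tm2ComputableInPolyTime {β : Type} (eb : β → List Γ) (f : List Bool → β)
    (h : PolyWord fun w _ => eb (f w)) :
    Nonempty (Turing.TM2ComputableInPolyTime (Computability.encodingList Bool).encode eb f) := by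
  obtain ⟨p, P, hp⟩ := h (fun _ => 0) 1 (by simp)
  -- The machine has to halt with all stacks but the output empty, so the input is dropped at the
  -- end.
  refine CounterProg.tm2ComputableInPolyTime eb f (.seq p (.while .right (.op .drop)))
    (P + (Polynomial.X * Polynomial.C 2 + 1)) fun w => ?_
  have h1 := hp ⟨fun _ => 0, w, [], []⟩ w.length rfl (by simp) le_rfl (by simp)
  have h2 : ∀ (w : List Bool) (o : List Γ), Runs (.while .right (.op .drop))
      ⟨fun _ => 0, w, [], o⟩ (w.length * 2 + 1) ⟨fun _ => 0, [], [], o⟩ := by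
    intro w o
    induction w with
    | nil => exact ⟨1, by simp, .whileF rfl⟩
    | cons b w ih =>
      obtain ⟨t, ht, h⟩ := ih
      refine ⟨1 + 1 + t, ?_, .whileT rfl (.op _ _) h⟩
      simp only [List.length_cons]
      omega
  have := h1.seq (h2 w _)
  simpa [Runs] using this

end PolyWord

/-! ### Bit machines -/

/-- A machine with `size` bits of memory and the control states `0, …, ctrl - 1`. In control state
`c` the bit `addr c` is read and replaced by `wr c`, and the next control state depends on the bit
that has been read. The machine halts if there is no bit with the number `addr c`. -/
structure BitMachine where
  /-- the number of bits -/
  size : ℕ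
  /-- the number of control states -/
  ctrl : ℕ
  /-- the address of the bit that is accessed -/
  addr : ℕ → ℕ
  /-- the new value of the bit -/
  wr : ℕ → Bool
  /-- the next control state -/
  next : ℕ → Bool → ℕ
  next_lt : ∀ c v, c < ctrl → next c v < ctrl

namespace BitMachine

variable (M : BitMachine)

/-- One step of a bit machine. -/
def Step (x y : ℕ × (ℕ → Bool)) : Prop :=
  M.addr x.1 < M.size ∧
    y = (M.next x.1 (x.2 (M.addr x.1)), update x.2 (M.addr x.1) (M.wr x.1))

/-! ### The anonymous game of a bit machine

The strategies are `0` (idle, or a bit with value 0), `1` (a bit with value 1), `2` (a bit that is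
being accessed), `3` and `4` (units of two unary counters), `5` and `6` (stages of the clock). -/

/-- The code for the control state `c` if `o` bits have the value 1. -/
def code (c o : ℕ) : ℕ := 2 * c + o % 2

/-- The code for the next control state, given the present code and the number of bits with value
1 besides the bit that is being accessed. -/
def target (a o : ℕ) : ℕ :=
  -- The code `a` keeps the parity of the number of ones before the bit was taken out, so `a + o` is
  -- odd exactly if that bit was 1.
  code (M.next (a / 2) (decide ((a + o) % 2 = 1))) (o + if M.wr (a / 2) = true then 1 else 0)

/-- The strategy that player `i` wants to play, by the numbers of the other players on the
strategies; `7` if all strategies are the same for him. -/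
def wish (i : ℕ) (x : ℕ → ℕ) : ℕ :=
  if i < M.size then
    if (x 5 = 0 ∧ x 6 = 0) ∧ M.addr (x 3 / 2) = i then 2
    else if x 5 = 1 ∧ M.addr (x 3 / 2) = i then if M.wr (x 3 / 2) = true then 1 else 0
    else 7
  else if i < M.size + 2 * M.ctrl then
    -- The units of a counter fill an initial segment of its block. Since players do not count
    -- themselves, `x 3` equals the player's own index only for the last player of this segment and
    -- the first one after it, so only these two can have a wish.
    if x 6 = 1 ∧ i = M.size + x 3 then if x 3 < x 4 then 3 else 0 else 7
  else if i < M.size + 2 * M.ctrl + 2 * M.ctrl then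
    if ((x 5 = 0 ∧ x 6 = 0) ∧ x 2 = 1) ∧ i = M.size + 2 * M.ctrl + x 4 then
      if x 4 < M.target (x 3) (x 1) then 4 else 0
    else 7
  -- While a bit is being accessed, the clock waits for the second counter. Otherwise it shows
  -- whether the two counters still have to be equalized.
  else if x 2 = 1 then if x 4 = M.target (x 3) (x 1) then 5 else 7
  else if x 3 = x 4 then 0 else 6

/-- The number of players. -/
def players : ℕ := M.size + 2 * M.ctrl + 2 * M.ctrl + 1

/-- A function on `Fin 7` as a function on the natural numbers. -/
def ext7 (x : Fin 7 → ℕ) (j : ℕ) : ℕ := if h : j < 7 then x ⟨j, h⟩ else 0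

/-- The anonymous game of a bit machine. -/
def game : AnonymousGame M.players 7 where
  util i a x := if M.wish i (ext7 x.1) = a then 1 else 0

/-- The strategy that a player wants to play in a profile. -/
def wishAt (s : Fin M.players → Fin 7) (i : Fin M.players) : ℕ :=
  M.wish i (ext7 (AnonymousGame.others s i).1)

theorem others_update (s : Fin M.players → Fin 7) (i : Fin M.players) (a : Fin 7) :
    AnonymousGame.others (update s i a) i = AnonymousGame.others s i := by
  refine Subtype.ext (funext fun j => ?_)
  simp only [AnonymousGame.others]
  refine congrArg Finset.card (Finset.filter_congr fun i' hi => ?_)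
  rw [update_of_ne (Finset.ne_of_mem_erase hi)]

/-- The wish does not depend on the player's own strategy, and the utility is 1 for the wished
strategy and 0 for all others. Hence the improving moves are those that fulfil an unfulfilled wish;
the wish 7 is never fulfilled. -/
theorem arc_iff (s t : Fin M.players → Fin 7) :
    M.game.toStrategicGame.Arc s t ↔
      ∃ (i : Fin M.players) (a : Fin 7), M.wishAt s i = a ∧ s i ≠ a ∧ t = update s i a := by
  have key : ∀ (i : Fin M.players) (a : Fin 7),
      M.game.toStrategicGame.utility i s < M.game.toStrategicGame.utility i (update s i a) ↔
        M.wishAt s i = a ∧ s i ≠ a := by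
    intro i a
    simp only [AnonymousGame.toStrategicGame, game, others_update, update_self, wishAt]
    constructor
    · intro h
      by_cases h1 : M.wish i (ext7 (AnonymousGame.others s i).1) = a
      · refine ⟨h1, fun h2 => ?_⟩
        simp [h2] at h
      · rw [if_neg h1] at h
        split_ifs at h <;> norm_num at h
    · rintro ⟨h1, h2⟩
      rw [if_pos h1, if_neg fun h3 => h2 (Fin.ext (h3.symm.trans h1))]
      norm_num
  constructor
  · rintro ⟨i, a, rfl, h⟩
    exact ⟨i, a, ((key i a).1 h).1, ((key i a).1 h).2, rfl⟩
  · rintro ⟨i, a, h1, h2, rfl⟩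
    exact ⟨i, a, rfl, (key i a).2 ⟨h1, h2⟩⟩

/-- The only arc from `s` leads to `t`. -/
def Forced (s t : Fin M.players → Fin 7) : Prop :=
  M.game.toStrategicGame.Arc s t ∧ ∀ u, M.game.toStrategicGame.Arc s u → u = t

theorem forced_of_forall {s t : Fin M.players → Fin 7} (i : Fin M.players) (a : Fin 7)
    (h1 : M.wishAt s i = a) (h2 : s i ≠ a) (ht : t = update s i a)
    (h : ∀ i', i' ≠ i → M.wishAt s i' = s i' ∨ M.wishAt s i' = 7) : M.Forced s t := by
  refine ⟨(M.arc_iff s t).2 ⟨i, a, h1, h2, ht⟩, fun u hu => ?_⟩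
  obtain ⟨i', a', h3, h4, rfl⟩ := (M.arc_iff s u).1 hu
  by_cases hi : i' = i
  · subst hi
    rw [ht, Fin.ext (h1.symm.trans h3)]
  · rcases h i' hi with h5 | h5
    · exact absurd (Fin.ext (h5.symm.trans h3)) h4
    · have := a'.isLt
      omega

/-! #### Profiles -/

/-- The profile with the strategies `μ` of the bits, the values `a` and `b` of the counters and the
strategy `κ` of the clock. -/
def prof (μ : ℕ → Fin 7) (a b : ℕ) (κ : Fin 7) (i : ℕ) : Fin 7 :=
  if i < M.size then μ i
  else if i < M.size + 2 * M.ctrl then if i < M.size + a then 3 else 0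
  else if i < M.size + 2 * M.ctrl + 2 * M.ctrl then
    if i < M.size + 2 * M.ctrl + b then 4 else 0
  else κ

/-- The number of bits with strategy `j`. -/
def bitCount (μ : ℕ → Fin 7) (j : Fin 7) : ℕ := ∑ t ∈ Finset.range M.size, if μ t = j then 1 else 0

/-- The number of players with strategy `j ≠ 0` in a profile. -/
def count (μ : ℕ → Fin 7) (a b : ℕ) (κ : Fin 7) (j : ℕ) : ℕ :=
  if j = 3 then a else if j = 4 then b else if j = 1 then M.bitCount μ 1
  else if j = 2 then M.bitCount μ 2 else if (κ : ℕ) = j then 1 else 0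

theorem sum_range_lt (L a : ℕ) (h : a ≤ L) : (∑ t ∈ Finset.range L, if t < a then 1 else 0) = a := by
  rw [← Finset.sum_filter, ← Finset.card_eq_sum_ones]
  have : (Finset.range L).filter (fun t => t < a) = Finset.range a := by
    ext
    simp only [Finset.mem_filter, Finset.mem_range]
    omega
  rw [this, Finset.card_range]

theorem prof_mem {μ : ℕ → Fin 7} {a b : ℕ} {κ : Fin 7} {t : ℕ} (ht : t < M.size) :
    M.prof μ a b κ t = μ t := if_pos ht

theorem prof_fst {μ : ℕ → Fin 7} {a b : ℕ} {κ : Fin 7} {t : ℕ} (ht : t < 2 * M.ctrl) :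
    M.prof μ a b κ (M.size + t) = if t < a then 3 else 0 := by
  simp only [prof]
  rw [if_neg (by omega), if_pos (by omega)]
  simp

theorem prof_snd {μ : ℕ → Fin 7} {a b : ℕ} {κ : Fin 7} {t : ℕ} (ht : t < 2 * M.ctrl) :
    M.prof μ a b κ (M.size + 2 * M.ctrl + t) = if t < b then 4 else 0 := by
  simp only [prof]
  rw [if_neg (by omega), if_neg (by omega), if_pos (by omega)]
  simp

theorem prof_clock {μ : ℕ → Fin 7} {a b : ℕ} {κ : Fin 7} :
    M.prof μ a b κ (M.size + 2 * M.ctrl + 2 * M.ctrl) = κ := by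
  simp only [prof]
  rw [if_neg (by omega), if_neg (by omega), if_neg (by omega)]

/-- The strategies that the players of the several kinds may have in the profiles of a play. -/
structure Valid (μ : ℕ → Fin 7) (a b : ℕ) (κ : Fin 7) : Prop where
  bit : ∀ t, μ t = 0 ∨ μ t = 1 ∨ μ t = 2
  fst : a ≤ 2 * M.ctrl
  snd : b ≤ 2 * M.ctrl
  clock : κ = 0 ∨ κ = 5 ∨ κ = 6

variable {M}

/-- Strategy 0 is left out because bits with value 0, idle counter players and the clock share it;
no wish depends on its count. -/
theorem Valid.sum_prof {μ : ℕ → Fin 7} {a b : ℕ} {κ : Fin 7} (h : M.Valid μ a b κ) (j : Fin 7)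
    (hj : j ≠ 0) :
    (∑ i ∈ Finset.range M.players, if M.prof μ a b κ i = j then 1 else 0) = M.count μ a b κ j := by
  rw [players, Finset.sum_range_succ, Finset.sum_range_add, Finset.sum_range_add, prof_clock]
  rw [Finset.sum_congr rfl fun t ht => by rw [M.prof_mem (Finset.mem_range.1 ht)]]
  have e1 : (∑ t ∈ Finset.range (2 * M.ctrl), if M.prof μ a b κ (M.size + t) = j then 1 else 0)
      = if j = 3 then a else 0 := by
    split_ifs with h3
    · subst h3
      refine (Finset.sum_congr rfl fun t ht => ?_).trans (sum_range_lt _ a h.fst)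
      rw [M.prof_fst (Finset.mem_range.1 ht)]
      by_cases ht : t < a <;> simp [ht]
    · refine Finset.sum_eq_zero fun t ht => ?_
      rw [M.prof_fst (Finset.mem_range.1 ht)]
      by_cases ht : t < a <;> simp [ht, hj.symm, Ne.symm h3]
  have e2 : (∑ t ∈ Finset.range (2 * M.ctrl), if M.prof μ a b κ (M.size + 2 * M.ctrl + t) = j then 1 else 0)
      = if j = 4 then b else 0 := by
    split_ifs with h3
    · subst h3
      refine (Finset.sum_congr rfl fun t ht => ?_).trans (sum_range_lt _ b h.snd)
      rw [M.prof_snd (Finset.mem_range.1 ht)]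
      by_cases ht : t < b <;> simp [ht]
    · refine Finset.sum_eq_zero fun t ht => ?_
      rw [M.prof_snd (Finset.mem_range.1 ht)]
      by_cases ht : t < b <;> simp [ht, hj.symm, Ne.symm h3]
  have e3 : ∀ t, μ t ≠ 3 ∧ μ t ≠ 4 ∧ μ t ≠ 5 ∧ μ t ≠ 6 := by
    intro t
    rcases h.bit t with h0 | h0 | h0 <;> rw [h0] <;> decide
  rw [e1, e2, count, bitCount, bitCount]
  have hκ := h.clock
  fin_cases j
  · exact absurd rfl hj
  all_goals
    rcases hκ with rfl | rfl | rfl <;> simp [e3]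

theorem Valid.others_prof {μ : ℕ → Fin 7} {a b : ℕ} {κ : Fin 7} (h : M.Valid μ a b κ)
    (i : Fin M.players) (j : ℕ) (hj : j < 7) (hj0 : j ≠ 0) :
    ext7 (AnonymousGame.others (fun i : Fin M.players => M.prof μ a b κ i) i).1 j =
      M.count μ a b κ j - if (M.prof μ a b κ i : ℕ) = j then 1 else 0 := by
  have h1 := h.sum_prof ⟨j, hj⟩ (by simpa [Fin.ext_iff] using hj0)
  rw [← Fin.sum_univ_eq_sum_range (fun i => if M.prof μ a b κ i = ⟨j, hj⟩ then 1 else 0)] at h1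
  simp only at h1
  rw [← h1, ext7, dif_pos hj, ← Finset.add_sum_erase _ _ (Finset.mem_univ i), ← Finset.card_filter]
  simp only [Fin.ext_iff, AnonymousGame.others]
  omega

end BitMachine

/-! ### Wishes in the profiles of a play -/

namespace BitMachine

variable {M : BitMachine} {μ : ℕ → Fin 7} {a b : ℕ} {κ : Fin 7}

variable (M) in
/-- The profile `prof` of the game of `M`. -/
def profile (μ : ℕ → Fin 7) (a b : ℕ) (κ : Fin 7) (i : Fin M.players) : Fin 7 := M.prof μ a b κ i

theorem Valid.wishAt_bit (h : M.Valid μ a b κ) (i : Fin M.players) (hi : (i : ℕ) < M.size) :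
    M.wishAt (M.profile μ a b κ) i =
      if κ = 0 ∧ M.addr (a / 2) = i then 2
      else if κ = 5 ∧ M.addr (a / 2) = i then if M.wr (a / 2) = true then 1 else 0
      else 7 := by
  have hp := M.prof_mem (μ := μ) (a := a) (b := b) (κ := κ) hi
  have x3 := h.others_prof i 3 (by omega) (by omega)
  have x5 := h.others_prof i 5 (by omega) (by omega)
  have x6 := h.others_prof i 6 (by omega) (by omega)
  rw [hp] at x3 x5 x6
  have hc := h.clock
  unfold wishAt wish profile
  rw [if_pos hi, x3, x5, x6]
  simp only [count]
  rcases h.bit i with h0 | h0 | h0 <;> rw [h0] <;> rcases hc with rfl | rfl | rfl <;> simp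

/-- A player `t` in the segment sees `a - 1` others on strategy 3, a player outside sees `a`. So the
condition on the player's index holds just at `t + 1 = a` and `t = a`, and in both cases the count
seen is `t`. -/
theorem Valid.wishAt_fst (h : M.Valid μ a b κ) (i : Fin M.players) {t : ℕ} (ht : t < 2 * M.ctrl)
    (hi : (i : ℕ) = M.size + t) :
    M.wishAt (M.profile μ a b κ) i =
      if κ = 6 ∧ (t = a ∨ t + 1 = a) then if t < b then 3 else 0 else 7 := by
  have hp := M.prof_fst (μ := μ) (a := a) (b := b) (κ := κ) ht
  rw [← hi] at hp
  have x3 := h.others_prof i 3 (by omega) (by omega)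
  have x4 := h.others_prof i 4 (by omega) (by omega)
  have x6 := h.others_prof i 6 (by omega) (by omega)
  rw [hp] at x3 x4 x6
  have hc := h.clock
  unfold wishAt wish profile
  rw [if_neg (by omega), if_pos (by omega), x3, x4, x6, hi]
  simp only [count]
  by_cases hta : t < a
  · simp only [hta, if_true]
    rcases hc with rfl | rfl | rfl <;> simp
    split_ifs <;> omega
  · simp only [hta, if_false]
    rcases hc with rfl | rfl | rfl <;> simp
    split_ifs <;> omega

theorem Valid.wishAt_snd (h : M.Valid μ a b κ) (i : Fin M.players) {t : ℕ} (ht : t < 2 * M.ctrl)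
    (hi : (i : ℕ) = M.size + 2 * M.ctrl + t) :
    M.wishAt (M.profile μ a b κ) i =
      if (κ = 0 ∧ M.bitCount μ 2 = 1) ∧ (t = b ∨ t + 1 = b) then
        if t < M.target a (M.bitCount μ 1) then 4 else 0
      else 7 := by
  have hp := M.prof_snd (μ := μ) (a := a) (b := b) (κ := κ) ht
  rw [← hi] at hp
  have x1 := h.others_prof i 1 (by omega) (by omega)
  have x2 := h.others_prof i 2 (by omega) (by omega)
  have x3 := h.others_prof i 3 (by omega) (by omega)
  have x4 := h.others_prof i 4 (by omega) (by omega)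
  have x5 := h.others_prof i 5 (by omega) (by omega)
  have x6 := h.others_prof i 6 (by omega) (by omega)
  rw [hp] at x1 x2 x3 x4 x5 x6
  have hc := h.clock
  unfold wishAt wish profile
  rw [if_neg (by omega), if_neg (by omega), if_pos (by omega), x1, x2, x3, x4, x5, x6, hi]
  simp only [count]
  by_cases htb : t < b
  · simp only [htb, if_true]
    rcases hc with rfl | rfl | rfl <;> simp
    split_ifs <;> omega
  · simp only [htb, if_false]
    rcases hc with rfl | rfl | rfl <;> simp
    split_ifs <;> omega

theorem Valid.wishAt_clock (h : M.Valid μ a b κ) (i : Fin M.players)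
    (hi : (i : ℕ) = M.size + 2 * M.ctrl + 2 * M.ctrl) :
    M.wishAt (M.profile μ a b κ) i =
      if M.bitCount μ 2 = 1 then if b = M.target a (M.bitCount μ 1) then 5 else 7
      else if a = b then 0 else 6 := by
  have hp := M.prof_clock (μ := μ) (a := a) (b := b) (κ := κ)
  rw [← hi] at hp
  have x1 := h.others_prof i 1 (by omega) (by omega)
  have x2 := h.others_prof i 2 (by omega) (by omega)
  have x3 := h.others_prof i 3 (by omega) (by omega)
  have x4 := h.others_prof i 4 (by omega) (by omega)
  rw [hp] at x1 x2 x3 x4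
  have hc := h.clock
  unfold wishAt wish profile
  rw [if_neg (by omega), if_neg (by omega), if_neg (by omega), x1, x2, x3, x4]
  simp only [count]
  rcases hc with rfl | rfl | rfl <;> simp

theorem player_cases (i : Fin M.players) :
    (i : ℕ) < M.size ∨ (∃ t < 2 * M.ctrl, (i : ℕ) = M.size + t) ∨
      (∃ t < 2 * M.ctrl, (i : ℕ) = M.size + 2 * M.ctrl + t) ∨
      (i : ℕ) = M.size + 2 * M.ctrl + 2 * M.ctrl := by
  have : (i : ℕ) < M.size + 2 * M.ctrl + 2 * M.ctrl + 1 := i.isLt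
  rcases lt_or_ge (i : ℕ) M.size with h | h
  · exact .inl h
  rcases lt_or_ge (i : ℕ) (M.size + 2 * M.ctrl) with h1 | h1
  · exact .inr (.inl ⟨i - M.size, by omega, by omega⟩)
  rcases lt_or_ge (i : ℕ) (M.size + 2 * M.ctrl + 2 * M.ctrl) with h2 | h2
  · exact .inr (.inr (.inl ⟨i - (M.size + 2 * M.ctrl), by omega, by omega⟩))
  · exact .inr (.inr (.inr (by omega)))

/-- The conditions for no player other than `i` to have an incentive to move. -/
structure Quiet (M : BitMachine) (μ : ℕ → Fin 7) (a b : ℕ) (κ : Fin 7) (i : ℕ) : Prop where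
  access : ∀ t < M.size, t ≠ i → κ = 0 → M.addr (a / 2) = t → μ t = 2
  write : ∀ t < M.size, t ≠ i → κ = 5 → M.addr (a / 2) = t →
    μ t = if M.wr (a / 2) = true then 1 else 0
  fst : ∀ t < 2 * M.ctrl, M.size + t ≠ i → κ = 6 → (t = a ∨ t + 1 = a) → (t < a ↔ t < b)
  snd : ∀ t < 2 * M.ctrl, M.size + 2 * M.ctrl + t ≠ i → κ = 0 → M.bitCount μ 2 = 1 →
    (t = b ∨ t + 1 = b) → (t < b ↔ t < M.target a (M.bitCount μ 1))
  clock : M.size + 2 * M.ctrl + 2 * M.ctrl ≠ i → M.bitCount μ 2 = 1 →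
    b = M.target a (M.bitCount μ 1) → κ = 5
  clock' : M.size + 2 * M.ctrl + 2 * M.ctrl ≠ i → M.bitCount μ 2 ≠ 1 →
    κ = if a = b then 0 else 6

theorem Quiet.satisfied {i : ℕ} (hq : M.Quiet μ a b κ i) (h : M.Valid μ a b κ)
    (i' : Fin M.players) (hi : (i' : ℕ) ≠ i) :
    M.wishAt (M.profile μ a b κ) i' = M.profile μ a b κ i' ∨
      M.wishAt (M.profile μ a b κ) i' = 7 := by
  rcases player_cases i' with hc | ⟨t, ht, hc⟩ | ⟨t, ht, hc⟩ | hc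
  · rw [h.wishAt_bit i' hc, profile, prof_mem _ hc]
    split_ifs with h1 h2 h3
    · rw [hq.access _ hc hi h1.1 h1.2]
      exact .inl rfl
    · rw [hq.write _ hc hi h2.1 h2.2, if_pos h3]
      exact .inl rfl
    · rw [hq.write _ hc hi h2.1 h2.2, if_neg h3]
      exact .inl rfl
    · exact .inr rfl
  · rw [h.wishAt_fst i' ht hc, profile, hc, prof_fst _ ht]
    split_ifs with h1 h2 h3 h3
    · exact .inl rfl
    · exact absurd ((hq.fst t ht (by omega) h1.1 h1.2).2 h2) h3
    · exact absurd ((hq.fst t ht (by omega) h1.1 h1.2).1 h3) h2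
    · exact .inl rfl
    all_goals exact .inr rfl
  · rw [h.wishAt_snd i' ht hc, profile, hc, prof_snd _ ht]
    split_ifs with h1 h2 h3 h3
    · exact .inl rfl
    · exact absurd ((hq.snd t ht (by omega) h1.1.1 h1.1.2 h1.2).2 h2) h3
    · exact absurd ((hq.snd t ht (by omega) h1.1.1 h1.1.2 h1.2).1 h3) h2
    · exact .inl rfl
    all_goals exact .inr rfl
  · rw [h.wishAt_clock i' hc, profile, hc, prof_clock]
    split_ifs with h1 h2 h3
    · rw [hq.clock (by omega) h1 h2]
      exact .inl rfl
    · exact .inr rfl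
    · rw [hq.clock' (by omega) h1, if_pos h3]
      exact .inl rfl
    · rw [hq.clock' (by omega) h1, if_neg h3]
      exact .inl rfl

theorem Quiet.forced {i : Fin M.players} (hq : M.Quiet μ a b κ i) (h : M.Valid μ a b κ) {v : Fin 7}
    (hw : M.wishAt (M.profile μ a b κ) i = v) (hv : M.profile μ a b κ i ≠ v)
    {s : Fin M.players → Fin 7} (hs : s = update (M.profile μ a b κ) i v) :
    M.Forced (M.profile μ a b κ) s :=
  M.forced_of_forall i v hw hv hs fun i' hi => hq.satisfied h i' fun h' => hi (Fin.ext h')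

/-! #### Changes of profiles and numbers of bits -/

theorem profile_update_bit (t : ℕ) (ht : t < M.size) (v : Fin 7) :
    M.profile (update μ t v) a b κ =
      update (M.profile μ a b κ) ⟨t, by unfold players; omega⟩ v := by
  funext i
  rcases eq_or_ne (i : ℕ) t with h | h
  · obtain ⟨i, hi⟩ := i
    obtain rfl : i = _ := h
    simp [profile, prof, ht]
  · rw [update_of_ne fun h' => h (congrArg Fin.val h')]
    simp only [profile, prof, update_of_ne h]

theorem profile_fst_succ (ha : a < 2 * M.ctrl) :
    M.profile μ (a + 1) b κ =
      update (M.profile μ a b κ) ⟨M.size + a, by unfold players; omega⟩ 3 := by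
  funext i
  rcases eq_or_ne (i : ℕ) (M.size + a) with h | h
  · obtain ⟨i, hi⟩ := i
    obtain rfl : i = _ := h
    simp [profile, prof, ha]
  · rw [update_of_ne fun h' => h (congrArg Fin.val h')]
    simp only [profile, prof, show (i : ℕ) < M.size + (a + 1) ↔ (i : ℕ) < M.size + a by omega]

theorem profile_fst_pred (ha : a < 2 * M.ctrl) :
    M.profile μ a b κ =
      update (M.profile μ (a + 1) b κ) ⟨M.size + a, by unfold players; omega⟩ 0 := by
  rw [profile_fst_succ ha, update_idem, eq_comm]
  refine update_eq_self_iff.2 ?_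
  simp [profile, prof_fst _ ha]

theorem profile_snd_succ (hb : b < 2 * M.ctrl) :
    M.profile μ a (b + 1) κ =
      update (M.profile μ a b κ) ⟨M.size + 2 * M.ctrl + b, by unfold players; omega⟩ 4 := by
  funext i
  rcases eq_or_ne (i : ℕ) (M.size + 2 * M.ctrl + b) with h | h
  · obtain ⟨i, hi⟩ := i
    obtain rfl : i = _ := h
    simp only [profile, update_self]
    rw [prof_snd _ hb, if_pos (by omega)]
  · rw [update_of_ne fun h' => h (congrArg Fin.val h')]
    simp only [profile, prof,
      show (i : ℕ) < M.size + 2 * M.ctrl + (b + 1) ↔ (i : ℕ) < M.size + 2 * M.ctrl + b by omega]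

theorem profile_snd_pred (hb : b < 2 * M.ctrl) :
    M.profile μ a b κ =
      update (M.profile μ a (b + 1) κ) ⟨M.size + 2 * M.ctrl + b, by unfold players; omega⟩ 0 := by
  rw [profile_snd_succ hb, update_idem, eq_comm]
  refine update_eq_self_iff.2 ?_
  simp [profile, prof_snd _ hb]

theorem profile_clock (κ' : Fin 7) :
    M.profile μ a b κ' = update (M.profile μ a b κ)
      ⟨M.size + 2 * M.ctrl + 2 * M.ctrl, by unfold players; omega⟩ κ' := by
  funext i
  rcases eq_or_ne (i : ℕ) (M.size + 2 * M.ctrl + 2 * M.ctrl) with h | h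
  · obtain ⟨i, hi⟩ := i
    obtain rfl : i = _ := h
    simp only [profile, update_self, prof_clock]
  · rw [update_of_ne fun h' => h (congrArg Fin.val h')]
    have : (i : ℕ) < M.size + 2 * M.ctrl + 2 * M.ctrl + 1 := i.isLt
    have h1 : (i : ℕ) < M.size + 2 * M.ctrl + 2 * M.ctrl := by omega
    simp only [profile, prof, h1, if_true]

/-- The additive form avoids truncated subtraction. -/
theorem bitCount_update (μ : ℕ → Fin 7) {t : ℕ} (ht : t < M.size) (v j : Fin 7) :
    M.bitCount (update μ t v) j + (if μ t = j then 1 else 0) =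
      M.bitCount μ j + if v = j then 1 else 0 := by
  have ht' := Finset.mem_range.2 ht
  unfold bitCount
  rw [← Finset.add_sum_erase _ _ ht', ← Finset.add_sum_erase (Finset.range M.size)
    (fun t => if μ t = j then 1 else 0) ht',
    Finset.sum_congr rfl fun x hx => by rw [update_of_ne (Finset.ne_of_mem_erase hx)], update_self]
  omega

/-- The strategies that represent the values of the bits. -/
def bits (mem : ℕ → Bool) (t : ℕ) : Fin 7 := if mem t = true then 1 else 0

theorem bits_update (mem : ℕ → Bool) (t : ℕ) (v : Bool) :
    bits (update mem t v) = update (bits mem) t (if v = true then 1 else 0) := by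
  funext i
  rcases eq_or_ne i t with rfl | h
  · simp [bits]
  · simp [bits, h]

theorem bitCount_bits_two (mem : ℕ → Bool) : M.bitCount (bits mem) 2 = 0 :=
  Finset.sum_eq_zero fun t _ => by
    unfold bits
    split_ifs <;> simp_all

theorem bit_update {μ : ℕ → Fin 7} (h : ∀ t, μ t = 0 ∨ μ t = 1 ∨ μ t = 2) (t : ℕ) {v : Fin 7}
    (hv : v = 0 ∨ v = 1 ∨ v = 2) : ∀ i, update μ t v i = 0 ∨ update μ t v i = 1 ∨ update μ t v i = 2 := by
  intro i
  rcases eq_or_ne i t with rfl | h'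
  · simpa using hv
  · simpa [h'] using h i

theorem bit_bits (mem : ℕ → Bool) (t : ℕ) : bits mem t = 0 ∨ bits mem t = 1 ∨ bits mem t = 2 := by
  unfold bits
  split_ifs <;> simp

end BitMachine

/-! ### Forced moves in the stages of the clock -/

namespace BitMachine

variable {M : BitMachine} {μ : ℕ → Fin 7} {a b : ℕ} {κ : Fin 7}

/-- Equal counters and no access in progress keep the clock at 0 and the counters at rest, so only
the addressed bit is discontent. -/
theorem forced_access (h : M.Valid μ a a 0) (hμ : M.bitCount μ 2 ≠ 1) (ht : M.addr (a / 2) < M.size)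
    (h2 : μ (M.addr (a / 2)) ≠ 2) :
    M.Forced (M.profile μ a a 0) (M.profile (update μ (M.addr (a / 2)) 2) a a 0) := by
  refine Quiet.forced (i := ⟨M.addr (a / 2), by unfold players; omega⟩) ⟨?_, ?_, ?_, ?_, ?_, ?_⟩ h ?_ ?_
    (profile_update_bit _ ht _)
  · exact fun t _ hne _ h' => absurd h'.symm hne
  · exact fun t _ _ h0 => absurd h0 (by decide)
  · exact fun t _ _ h0 => absurd h0 (by decide)
  · exact fun t _ _ _ h0 => absurd h0 hμ
  · exact fun _ h0 => absurd h0 hμ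
  · exact fun _ _ => (if_pos rfl).symm
  · rw [h.wishAt_bit _ ht]
    simp
  · simpa [profile, M.prof_mem ht] using h2

/-- The clock waits as long as the target is missed, and the accessed bit is content. Of the two
players at the end of the counter's segment only the one on the side of the target wants to move. -/
theorem forced_snd (h : M.Valid μ a b 0) (hμ : M.bitCount μ 2 = 1) (ht : μ (M.addr (a / 2)) = 2)
    (hb : b ≠ M.target a (M.bitCount μ 1)) (hT : M.target a (M.bitCount μ 1) ≤ 2 * M.ctrl) :
    M.Forced (M.profile μ a b 0)
      (M.profile μ a (if b < M.target a (M.bitCount μ 1) then b + 1 else b - 1) 0) := by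
  have hb2 := h.snd
  split_ifs with hlt
  · refine Quiet.forced (i := ⟨M.size + 2 * M.ctrl + b, by unfold players; omega⟩)
      ⟨?_, ?_, ?_, ?_, ?_, ?_⟩ h (v := 4) ?_ ?_ (profile_snd_succ (by omega))
    · exact fun t _ hne _ h' => h' ▸ ht
    · exact fun t _ _ h0 => absurd h0 (by decide)
    · exact fun t _ _ h0 => absurd h0 (by decide)
    · intro t _ hne _ _ _
      dsimp only at hne
      omega
    · exact fun _ _ h0 => absurd h0 hb
    · exact fun _ h0 => absurd hμ h0
    · rw [h.wishAt_snd (t := b) _ (by omega) rfl]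
      simp [hμ, hlt]
    · simp [profile, M.prof_snd (show b < 2 * M.ctrl by omega)]
  · obtain ⟨b, rfl⟩ : ∃ b', b = b' + 1 := ⟨b - 1, by omega⟩
    refine Quiet.forced (i := ⟨M.size + 2 * M.ctrl + b, by unfold players; omega⟩)
      ⟨?_, ?_, ?_, ?_, ?_, ?_⟩ h (v := 0) ?_ ?_ (profile_snd_pred (by omega))
    · exact fun t _ hne _ h' => h' ▸ ht
    · exact fun t _ _ h0 => absurd h0 (by decide)
    · exact fun t _ _ h0 => absurd h0 (by decide)
    · intro t _ hne _ _ _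
      dsimp only at hne
      omega
    · exact fun _ _ h0 => absurd h0 hb
    · exact fun _ h0 => absurd hμ h0
    · rw [h.wishAt_snd (t := b) _ (by omega) rfl]
      simp [hμ]
      omega
    · simp [profile, M.prof_snd (show b < 2 * M.ctrl by omega)]

theorem path_snd (h : ∀ t, μ t = 0 ∨ μ t = 1 ∨ μ t = 2) (ha : a ≤ 2 * M.ctrl)
    (hμ : M.bitCount μ 2 = 1) (ht : μ (M.addr (a / 2)) = 2)
    (hT : M.target a (M.bitCount μ 1) ≤ 2 * M.ctrl) (b : ℕ) (hb : b ≤ 2 * M.ctrl) :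
    Relation.ReflTransGen M.Forced (M.profile μ a b 0)
      (M.profile μ a (M.target a (M.bitCount μ 1)) 0) := by
  set T := M.target a (M.bitCount μ 1) with hTdef
  -- One of the two truncated differences vanishes, so the sum is the distance to the target, which
  -- each move reduces by one.
  induction hd : (T - b) + (b - T) generalizing b with
  | zero =>
    rw [show b = T by omega]
  | succ d ih =>
    have hf := forced_snd ⟨h, ha, hb, .inl rfl⟩ hμ ht (by omega) hT
    rw [← hTdef] at hf
    exact .head hf (ih _ (by split_ifs <;> omega) (by split_ifs <;> omega))

theorem forced_clock_write (h : M.Valid μ a b 0) (hμ : M.bitCount μ 2 = 1)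
    (ht : μ (M.addr (a / 2)) = 2) (hb : b = M.target a (M.bitCount μ 1)) :
    M.Forced (M.profile μ a b 0) (M.profile μ a b 5) := by
  refine Quiet.forced (i := ⟨M.size + 2 * M.ctrl + 2 * M.ctrl, by unfold players; omega⟩)
    ⟨?_, ?_, ?_, ?_, ?_, ?_⟩ h ?_ ?_ (profile_clock _)
  · exact fun t _ hne _ h' => h' ▸ ht
  · exact fun t _ _ h0 => absurd h0 (by decide)
  · exact fun t _ _ h0 => absurd h0 (by decide)
  · intro t _ _ _ _ _
    rw [hb]
  · exact fun h0 => absurd rfl h0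
  · exact fun h0 => absurd rfl h0
  · rw [h.wishAt_clock _ rfl, if_pos hμ, if_pos hb]
    rfl
  · simp [profile, M.prof_clock]

/-- At stage 5 the counters rest, and the clock stays there until the accessed bit has left strategy
2. -/
theorem forced_write (h : M.Valid μ a b 5) (hμ : M.bitCount μ 2 = 1)
    (ht : M.addr (a / 2) < M.size) (h2 : μ (M.addr (a / 2)) = 2) :
    M.Forced (M.profile μ a b 5)
      (M.profile (update μ (M.addr (a / 2)) (if M.wr (a / 2) = true then 1 else 0)) a b 5) := by
  refine Quiet.forced (i := ⟨M.addr (a / 2), by unfold players; omega⟩) ⟨?_, ?_, ?_, ?_, ?_, ?_⟩ h ?_ ?_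
    (profile_update_bit _ ht _)
  · exact fun t _ _ h0 => absurd h0 (by decide)
  · exact fun t _ hne _ h' => absurd h'.symm hne
  · exact fun t _ _ h0 => absurd h0 (by decide)
  · exact fun t _ _ h0 => absurd h0 (by decide)
  · exact fun _ _ _ => rfl
  · exact fun _ h0 => absurd hμ h0
  · rw [h.wishAt_bit _ ht, if_neg fun h0 => absurd h0.1 (by decide), if_pos ⟨rfl, rfl⟩]
    split_ifs <;> rfl
  · rw [profile, M.prof_mem ht, h2]
    split_ifs <;> decide

/-- With the bit written, the only discontent player is the clock, which skips the copying stage if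
the code has not changed. -/
theorem forced_clock_copy (h : M.Valid μ a b 5) (hμ : M.bitCount μ 2 ≠ 1)
    (ht : μ (M.addr (a / 2)) = if M.wr (a / 2) = true then 1 else 0) :
    M.Forced (M.profile μ a b 5) (M.profile μ a b (if a = b then 0 else 6)) := by
  refine Quiet.forced (i := ⟨M.size + 2 * M.ctrl + 2 * M.ctrl, by unfold players; omega⟩)
    ⟨?_, ?_, ?_, ?_, ?_, ?_⟩ h ?_ ?_ (profile_clock _)
  · exact fun t _ _ h0 => absurd h0 (by decide)
  · exact fun t _ hne _ h' => h' ▸ ht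
  · exact fun t _ _ h0 => absurd h0 (by decide)
  · exact fun t _ _ h0 => absurd h0 (by decide)
  · exact fun h0 => absurd rfl h0
  · exact fun h0 => absurd rfl h0
  · rw [h.wishAt_clock _ rfl, if_neg hμ]
    split_ifs <;> rfl
  · simp only [profile, M.prof_clock]
    split_ifs <;> decide

/-- Unequal counters hold the clock at 6, where bits and second counter rest, so only the end of the
first counter's segment can move, towards the second counter. -/
theorem forced_fst (h : M.Valid μ a b 6) (hμ : M.bitCount μ 2 ≠ 1) (hab : a ≠ b) :
    M.Forced (M.profile μ a b 6) (M.profile μ (if a < b then a + 1 else a - 1) b 6) := by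
  have ha2 := h.fst
  have hb2 := h.snd
  split_ifs with hlt
  · refine Quiet.forced (i := ⟨M.size + a, by unfold players; omega⟩)
      ⟨?_, ?_, ?_, ?_, ?_, ?_⟩ h (v := 3) ?_ ?_ (profile_fst_succ (by omega))
    · exact fun t _ _ h0 => absurd h0 (by decide)
    · exact fun t _ _ h0 => absurd h0 (by decide)
    · intro t _ hne _ _
      dsimp only at hne
      omega
    · exact fun t _ _ h0 => absurd h0 (by decide)
    · exact fun _ h0 => absurd h0 hμ
    · exact fun _ _ => (if_neg hab).symm
    · rw [h.wishAt_fst (t := a) _ (by omega) rfl]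
      simp [hlt]
    · simp [profile, M.prof_fst (show a < 2 * M.ctrl by omega)]
  · obtain ⟨a, rfl⟩ : ∃ a', a = a' + 1 := ⟨a - 1, by omega⟩
    refine Quiet.forced (i := ⟨M.size + a, by unfold players; omega⟩)
      ⟨?_, ?_, ?_, ?_, ?_, ?_⟩ h (v := 0) ?_ ?_ (profile_fst_pred (by omega))
    · exact fun t _ _ h0 => absurd h0 (by decide)
    · exact fun t _ _ h0 => absurd h0 (by decide)
    · intro t _ hne _ _
      dsimp only at hne
      omega
    · exact fun t _ _ h0 => absurd h0 (by decide)
    · exact fun _ h0 => absurd h0 hμ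
    · exact fun _ _ => (if_neg hab).symm
    · rw [h.wishAt_fst (t := a) _ (by omega) rfl]
      simp
      omega
    · simp [profile, M.prof_fst (show a < 2 * M.ctrl by omega)]

theorem path_fst (h : ∀ t, μ t = 0 ∨ μ t = 1 ∨ μ t = 2) (hb : b ≤ 2 * M.ctrl)
    (hμ : M.bitCount μ 2 ≠ 1) (a : ℕ) (ha : a ≤ 2 * M.ctrl) :
    Relation.ReflTransGen M.Forced (M.profile μ a b 6) (M.profile μ b b 6) := by
  induction hd : (a - b) + (b - a) generalizing a with
  | zero => rw [show a = b by omega]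
  | succ d ih =>
    have hf := forced_fst ⟨h, ha, hb, .inr (.inr rfl)⟩ hμ (show a ≠ b by omega)
    exact .head hf (ih _ (by split_ifs <;> omega) (by split_ifs <;> omega))

theorem forced_clock_access (h : M.Valid μ a a 6) (hμ : M.bitCount μ 2 ≠ 1) :
    M.Forced (M.profile μ a a 6) (M.profile μ a a 0) := by
  refine Quiet.forced (i := ⟨M.size + 2 * M.ctrl + 2 * M.ctrl, by unfold players; omega⟩)
    ⟨?_, ?_, ?_, ?_, ?_, ?_⟩ h ?_ ?_ (profile_clock _)
  · exact fun t _ _ h0 => absurd h0 (by decide)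
  · exact fun t _ _ h0 => absurd h0 (by decide)
  · exact fun t _ _ _ _ => Iff.rfl
  · exact fun t _ _ h0 => absurd h0 (by decide)
  · exact fun h0 => absurd rfl h0
  · exact fun h0 => absurd rfl h0
  · rw [h.wishAt_clock _ rfl, if_neg hμ, if_pos rfl]
    rfl
  · simp [profile, M.prof_clock]

/-! #### Simulation -/

variable (M) in
/-- The profile that represents a configuration of a bit machine. -/
def encode (x : ℕ × (ℕ → Bool)) : Fin M.players → Fin 7 :=
  M.profile (bits x.2) (code x.1 (M.bitCount (bits x.2) 1)) (code x.1 (M.bitCount (bits x.2) 1)) 0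

theorem code_lt {c C : ℕ} (h : c < C) (o : ℕ) : code c o < 2 * C := by
  unfold code
  omega

theorem code_div (c o : ℕ) : code c o / 2 = c := by
  unfold code
  omega

/-- A step of a bit machine becomes a path of forced moves. -/
theorem Step.path {x y : ℕ × (ℕ → Bool)} (h : M.Step x y) (hx : x.1 < M.ctrl) :
    Relation.TransGen M.Forced (M.encode x) (M.encode y) := by
  obtain ⟨c, mem⟩ := x
  obtain ⟨ht, rfl⟩ := h
  simp only at ht hx
  unfold encode
  simp only
  set o := M.bitCount (bits mem) 1 with ho
  set t := M.addr c with htdef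
  set a := code c o with hadef
  have ha : a < 2 * M.ctrl := code_lt hx o
  have hac : a / 2 = c := code_div c o
  have hta : M.addr (a / 2) = t := by rw [hac]
  set mem' := update mem t (M.wr c) with hmem'
  set μ' := update (bits mem) t 2 with hμ'
  have h2 : M.bitCount μ' 2 = 1 := by
    have := M.bitCount_update (bits mem) ht 2 2
    rw [bitCount_bits_two, ← hμ'] at this
    have h0 : bits mem t ≠ 2 := by unfold bits; split_ifs <;> decide
    simpa [h0] using this
  have h1 : M.bitCount μ' 1 + (if mem t = true then 1 else 0) = o := by
    have := M.bitCount_update (bits mem) ht 2 1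
    rw [← hμ', ← ho] at this
    have h0 : bits mem t = 1 ↔ mem t = true := by unfold bits; split_ifs <;> simp_all
    simpa [h0] using this
  have h1' : M.bitCount (bits mem') 1 = M.bitCount μ' 1 + if M.wr c = true then 1 else 0 := by
    have := M.bitCount_update (bits mem) ht (if M.wr c = true then 1 else 0) 1
    have h0 : bits mem t = 1 ↔ mem t = true := by unfold bits; split_ifs <;> simp_all
    have h0' : (if M.wr c = true then (1 : Fin 7) else 0) = 1 ↔ M.wr c = true := by
      split_ifs <;> simp_all
    rw [← bits_update, ← hmem', ← ho] at this
    simp only [h0, h0'] at this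
    omega
  have hT : M.target a (M.bitCount μ' 1) = code (M.next c (mem t)) (M.bitCount (bits mem') 1) := by
    unfold target
    rw [hac, h1']
    congr 2
    -- The number of ones has dropped by the value of the accessed bit since `a` was formed, so its
    -- parity against that in `a` is this value.
    have : (a + M.bitCount μ' 1) % 2 = if mem t = true then 1 else 0 := by
      rw [← h1] at hadef
      rw [hadef]
      unfold code
      split_ifs <;> omega
    rw [this]
    cases mem t <;> simp
  set T := code (M.next c (mem t)) (M.bitCount (bits mem') 1) with hTdef
  have hTlt : T < 2 * M.ctrl := code_lt (M.next_lt _ _ hx) _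
  have hbit' : ∀ i, μ' i = 0 ∨ μ' i = 1 ∨ μ' i = 2 := bit_update (bit_bits mem) t (by simp)
  have hμt : μ' (M.addr (a / 2)) = 2 := by rw [hta, hμ', update_self]
  have hmem2 : M.bitCount (bits mem') 2 ≠ 1 := by rw [bitCount_bits_two]; omega
  -- the bit is accessed
  have s1 : M.Forced (M.profile (bits mem) a a 0) (M.profile μ' a a 0) := by
    have := forced_access (M := M) ⟨bit_bits mem, ha.le, ha.le, .inl rfl⟩
      (by rw [bitCount_bits_two]; omega) (by rwa [hta])
      (by unfold bits; split_ifs <;> decide)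
    rwa [hta] at this
  -- the second counter moves
  have s2 := path_snd hbit' ha.le h2 hμt (by omega) a ha.le
  rw [hT] at s2
  have s3 := forced_clock_write (M := M) ⟨hbit', ha.le, hTlt.le, .inl rfl⟩ h2 hμt hT.symm
  -- the bit is written
  have s4 := forced_write (M := M) ⟨hbit', ha.le, hTlt.le, .inr (.inl rfl)⟩ h2 (by rwa [hta]) hμt
  rw [hta, hac, hμ', update_idem, ← bits_update, ← hmem'] at s4
  have s5 := forced_clock_copy (M := M) ⟨bit_bits mem', ha.le, hTlt.le, .inr (.inl rfl)⟩ hmem2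
    (by rw [hta, hac, hmem', bits_update, update_self])
  have s6 : Relation.ReflTransGen M.Forced (M.profile (bits mem') a T (if a = T then 0 else 6))
      (M.profile (bits mem') T T 0) := by
    split_ifs with haT
    · rw [haT]
    · exact (path_fst (bit_bits mem') hTlt.le hmem2 a ha.le).tail
        (forced_clock_access ⟨bit_bits mem', hTlt.le, hTlt.le, .inr (.inr rfl)⟩ hmem2)
  exact .head' s1 (s2.trans (.head s3 (.head s4 (.head s5 s6))))

/-- Profiles that represent halting configurations have no outgoing arcs. -/
theorem not_arc_encode {x : ℕ × (ℕ → Bool)} (hx : x.1 < M.ctrl) (h : M.size ≤ M.addr x.1)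
    (s : Fin M.players → Fin 7) : ¬ M.game.toStrategicGame.Arc (M.encode x) s := by
  have ha := code_lt hx (M.bitCount (bits x.2) 1)
  have hac := code_div x.1 (M.bitCount (bits x.2) 1)
  rw [arc_iff]
  rintro ⟨i, v, h1, h2, -⟩
  have hv : M.Valid (bits x.2) (code x.1 (M.bitCount (bits x.2) 1))
    (code x.1 (M.bitCount (bits x.2) 1)) 0 := ⟨bit_bits _, ha.le, ha.le, .inl rfl⟩
  -- The exempted index `M.players` belongs to no player, so nobody at all has an incentive to move.
  have hq : M.Quiet (bits x.2) (code x.1 (M.bitCount (bits x.2) 1))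
      (code x.1 (M.bitCount (bits x.2) 1)) 0 M.players := by
    refine ⟨?_, ?_, ?_, ?_, ?_, ?_⟩
    · intro t ht _ _ h'
      rw [hac] at h'
      omega
    · exact fun t _ _ h0 => absurd h0 (by decide)
    · exact fun t _ _ h0 => absurd h0 (by decide)
    · exact fun t _ _ _ h0 => absurd h0 (by rw [bitCount_bits_two]; omega)
    · exact fun _ h0 => absurd h0 (by rw [bitCount_bits_two]; omega)
    · exact fun _ _ => (if_pos rfl).symm
  rcases hq.satisfied hv i i.isLt.ne with h3 | h3
  · exact h2 (Fin.ext (h3.symm.trans h1))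
  · have := v.isLt
    have h4 : (7 : ℕ) = v := h3.symm.trans h1
    omega

/-! ### Sink equilibria and forced paths -/

theorem reachable_of_path {s t : Fin M.players → Fin 7} (h : Relation.ReflTransGen M.Forced s t) :
    M.game.toStrategicGame.Reachable s t := by
  induction h with
  | refl => exact .refl
  | tail _ h ih => exact ih.tail h.1

/-- A profile on a cycle of forced moves belongs to a sink equilibrium. -/
theorem mem_sink_of_cycle {s : Fin M.players → Fin 7} (h : Relation.TransGen M.Forced s s) :
    ∃ T, M.game.toStrategicGame.IsSinkEquilibrium T ∧ s ∈ T := by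
  -- The only arc out of a profile on the cycle is the forced one, so no arc leaves the cycle.
  have key : ∀ t u, Relation.ReflTransGen M.Forced s t → Relation.ReflTransGen M.Forced t s →
      M.game.toStrategicGame.Arc t u →
      Relation.ReflTransGen M.Forced s u ∧ Relation.ReflTransGen M.Forced u s := by
    intro t u hst hts hu
    have : Relation.TransGen M.Forced t s := by
      rcases Relation.reflTransGen_iff_eq_or_transGen.1 hts with rfl | h'
      · exact h
      · exact h'
    obtain ⟨v, hv, hvs⟩ := Relation.TransGen.head'_iff.1 this
    obtain rfl := hv.2 u hu
    exact ⟨hst.tail hv, hvs⟩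
  have hreach : ∀ t, M.game.toStrategicGame.Reachable s t →
      Relation.ReflTransGen M.Forced s t ∧ Relation.ReflTransGen M.Forced t s := by
    intro t ht
    induction ht with
    | refl => exact ⟨.refl, .refl⟩
    | tail _ hu ih => exact key _ _ ih.1 ih.2 hu
  refine ⟨{t | M.game.toStrategicGame.Reachable s t ∧ M.game.toStrategicGame.Reachable t s},
    ⟨⟨s, rfl⟩, ?_⟩, .refl, .refl⟩
  rintro t ⟨ht, -⟩ u hu
  obtain ⟨h1, h2⟩ := hreach u (ht.tail hu)
  exact ⟨reachable_of_path h1, reachable_of_path h2⟩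

/-- A profile from which a different profile without outgoing arcs can be reached does not belong
to a sink equilibrium. -/
theorem not_mem_sink {s t : Fin M.players → Fin 7} (h : Relation.TransGen M.Forced s t)
    (ht : ∀ u, ¬ M.game.toStrategicGame.Arc t u) (T : Set (Fin M.players → Fin 7))
    (hT : M.game.toStrategicGame.IsSinkEquilibrium T) (hs : s ∈ T) : False := by
  obtain ⟨⟨r, rfl⟩, hclosed⟩ := hT
  have hr := reachable_of_path h.to_reflTransGen
  have htT : ∀ u, M.game.toStrategicGame.Reachable s u →
      u ∈ {t | M.game.toStrategicGame.Reachable r t ∧ M.game.toStrategicGame.Reachable t r} := by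
    intro u hu
    induction hu with
    | refl => exact hs
    | tail _ hu ih => exact hclosed _ ih _ hu
  -- A sink equilibrium that contains `s` also contains `t`, so `t` would lead back to `s`. It has
  -- no arcs, and it is not `s`, which has one.
  have h1 : M.game.toStrategicGame.Reachable t s := (htT t hr).2.trans hs.1
  obtain ⟨v, hv, -⟩ := Relation.TransGen.head'_iff.1 h
  rcases Relation.ReflTransGen.cases_head h1 with h2 | ⟨u, hu, -⟩
  · exact ht v (h2 ▸ hv.1)
  · exact ht u hu

/-- Configurations with the same bits are represented by the same profile. -/
theorem encode_congr {c : ℕ} {mem mem' : ℕ → Bool} (h : ∀ t < M.size, mem t = mem' t) :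
    M.encode (c, mem) = M.encode (c, mem') := by
  have h1 : M.bitCount (bits mem) 1 = M.bitCount (bits mem') 1 :=
    Finset.sum_congr rfl fun t ht => by unfold bits; rw [h t (Finset.mem_range.1 ht)]
  unfold encode
  simp only [h1]
  funext i
  unfold profile prof
  split_ifs with hi
  · unfold bits; rw [h i hi]
  all_goals rfl

theorem path_of_steps {x y : ℕ × (ℕ → Bool)} (h : Relation.ReflTransGen M.Step x y)
    (hx : x.1 < M.ctrl) : y.1 < M.ctrl ∧ Relation.ReflTransGen M.Forced (M.encode x) (M.encode y) := by
  induction h with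
  | refl => exact ⟨hx, .refl⟩
  | tail _ hs ih =>
    refine ⟨?_, ih.2.trans (hs.path ih.1).to_reflTransGen⟩
    rw [hs.2]
    exact M.next_lt _ _ ih.1

/-- A configuration that recurs is represented by a profile in a sink equilibrium. -/
theorem mem_sink_of_recurrent {c : ℕ} {mem mem' : ℕ → Bool} (hc : c < M.ctrl)
    (h : Relation.TransGen M.Step (c, mem) (c, mem')) (hmem : ∀ t < M.size, mem' t = mem t) :
    ∃ T, M.game.toStrategicGame.IsSinkEquilibrium T ∧ M.encode (c, mem) ∈ T := by
  refine mem_sink_of_cycle ?_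
  obtain ⟨y, h1, h2⟩ := Relation.TransGen.head'_iff.1 h
  have hy : y.1 < M.ctrl := by rw [h1.2]; exact M.next_lt _ _ hc
  have := (h1.path hc).trans_left (path_of_steps h2 hy).2
  rwa [encode_congr (c := c) hmem] at this

/-- A configuration from which the machine halts, after at least one step, is represented by a
profile in no sink equilibrium. -/
theorem not_mem_sink_of_halts {x y : ℕ × (ℕ → Bool)} (hx : x.1 < M.ctrl)
    (h : Relation.TransGen M.Step x y) (hy : M.size ≤ M.addr y.1)
    (T : Set (Fin M.players → Fin 7)) (hT : M.game.toStrategicGame.IsSinkEquilibrium T) :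
    M.encode x ∉ T := by
  intro hs
  obtain ⟨z, h1, h2⟩ := Relation.TransGen.head'_iff.1 h
  have hz : z.1 < M.ctrl := by rw [h1.2]; exact M.next_lt _ _ hx
  obtain ⟨h3, h4⟩ := path_of_steps h2 hz
  exact not_mem_sink ((h1.path hx).trans_left h4) (not_arc_encode h3 hy) T hT hs

end BitMachine

namespace TapeMachine

/-! ### The bit machine of a Turing machine

The tape is represented by one bit for each cell and each symbol. -/

/-- The control states of the bit machine, up to the position of the head: the symbol under the head
is searched for, a symbol is written, or the initial tape is restored. -/
inductive LocalState (Q S : Type)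
  | read (q : Q) (γ : S)
  | write (q : Q) (γ : S) (d : Turing.Dir)
  | reset (γ : S)
  | stuck

instance (Q S : Type) [Finite Q] [Finite S] : Finite (LocalState Q S) := by
  refine Finite.of_surjective (α := (Q × S) ⊕ (Q × S × Bool) ⊕ S ⊕ Unit) (Sum.elim
    (fun x => .read x.1 x.2) (Sum.elim
      (fun x => .write x.1 x.2.1 (if x.2.2 then .left else .right))
      (Sum.elim .reset fun _ => .stuck))) ?_
  rintro (⟨q, γ⟩ | ⟨q, γ, _ | _⟩ | γ | _)
  · exact ⟨.inl (q, γ), rfl⟩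
  · exact ⟨.inr (.inl (q, γ, true)), rfl⟩
  · exact ⟨.inr (.inl (q, γ, false)), rfl⟩
  · exact ⟨.inr (.inr (.inl γ)), rfl⟩
  · exact ⟨.inr (.inr (.inr ())), rfl⟩

variable (T : TapeMachine)

/-- The number of symbols. -/
def numSymbols : ℕ := @Fintype.card T.Symbol T.symbolFintype

/-- A numbering of the symbols. -/
noncomputable def symbolEquiv : T.Symbol ≃ Fin T.numSymbols :=
  @Fintype.equivFin T.Symbol T.symbolFintype

theorem numSymbols_pos : 0 < T.numSymbols :=
  @Fintype.card_pos T.Symbol T.symbolFintype ⟨T.blank⟩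

/-- The number of the first symbol. -/
def firstSymbol : Fin T.numSymbols := ⟨0, T.numSymbols_pos⟩

/-- The control states of the bit machine of `T`, up to the position of the head. -/
abbrev Local : Type := LocalState T.State (Fin T.numSymbols)

instance : Finite T.Local :=
  have := T.stateFintype
  inferInstance

/-- The number of control states for one position of the head. -/
noncomputable def numLocal : ℕ := Nat.card T.Local

/-- A numbering of the control states for one position of the head. -/
noncomputable def localEquiv : T.Local ≃ Fin T.numLocal := Finite.equivFin T.Local

theorem numLocal_pos : 0 < T.numLocal := (T.localEquiv .stuck).pos

/-- The code of a control state. -/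
noncomputable def codeOf (h : ℕ) (e : T.Local) : ℕ := h * T.numLocal + T.localEquiv e

/-- The control state with a given code, up to the position of the head. -/
noncomputable def localOf (c : ℕ) : T.Local :=
  T.localEquiv.symm ⟨c % T.numLocal, Nat.mod_lt _ T.numLocal_pos⟩

@[simp] theorem codeOf_div (h : ℕ) (e : T.Local) : T.codeOf h e / T.numLocal = h := by
  rw [codeOf, add_comm, Nat.add_mul_div_right _ _ T.numLocal_pos,
    Nat.div_eq_of_lt (T.localEquiv e).isLt, zero_add]

@[simp] theorem localOf_codeOf (h : ℕ) (e : T.Local) : T.localOf (T.codeOf h e) = e := by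
  have : T.codeOf h e % T.numLocal = T.localEquiv e := by
    rw [codeOf, add_comm, Nat.add_mul_mod_self_right, Nat.mod_eq_of_lt (T.localEquiv e).isLt]
  simp [localOf, this]

theorem codeOf_lt {h m : ℕ} (hm : h < m) (e : T.Local) : T.codeOf h e < m * T.numLocal := by
  have h1 := (T.localEquiv e).isLt
  have h2 : (h + 1) * T.numLocal ≤ m * T.numLocal := Nat.mul_le_mul_right _ hm
  rw [Nat.succ_mul] at h2
  unfold codeOf
  omega

/-- The bit that represents the symbol with number `j` in cell `h` of the initial tape. -/
noncomputable def initBit (w : List Bool) (h j : ℕ) : Bool :=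
  decide ((T.symbolEquiv ((T.init w).tape h) : ℕ) = j)

/-- The address of the bit that is accessed, with the head on cell `h`. -/
def addrLocal (m h : ℕ) : T.Local → ℕ
  | .read _ j => h * T.numSymbols + j
  | .write _ j _ => h * T.numSymbols + j
  | .reset j => h * T.numSymbols + j
  -- The first address out of range, which makes the bit machine halt.
  | .stuck => m * T.numSymbols

/-- The bit that is written, with the head on cell `h`. -/
noncomputable def wrLocal (w : List Bool) (h : ℕ) : T.Local → Bool
  -- Reading clears the bit. This changes nothing until the symbol is found, and then erases it so
  -- that the new symbol can be entered.
  | .read _ _ => false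
  | .write _ _ _ => true
  | .reset j => T.initBit w h j
  | .stuck => false

open Classical in
/-- The control state after a symbol has been found. -/
noncomputable def foundLocal (h : ℕ) (q : T.State) (j : Fin T.numSymbols) : ℕ :=
  (T.trans q (T.symbolEquiv.symm j)).elim
    (if q ∈ T.accepting then T.codeOf 0 (.reset T.firstSymbol) else T.codeOf h .stuck)
    fun r => T.codeOf h (.write r.1 (T.symbolEquiv r.2.1) r.2.2)

/-- The next control state, with the head on cell `h`. -/
noncomputable def nextLocal (m h : ℕ) (v : Bool) : T.Local → ℕ
  | .read q j => if v = true then T.foundLocal h q j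
      -- The fallbacks to `stuck` here and after a move out of range keep `next` total; they do not
      -- occur in simulated runs, where every cell holds a symbol and the space bound is respected.
      else if hj : j + 1 < T.numSymbols then T.codeOf h (.read q ⟨j + 1, hj⟩) else T.codeOf h .stuck
  | .write q _ d => if move d h < m then T.codeOf (move d h) (.read q T.firstSymbol)
      else T.codeOf h .stuck
  | .reset j => if hj : j + 1 < T.numSymbols then T.codeOf h (.reset ⟨j + 1, hj⟩)
      else if h + 1 < m then T.codeOf (h + 1) (.reset T.firstSymbol)
      else T.codeOf 0 (.read T.start T.firstSymbol)
  | .stuck => T.codeOf h .stuck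

/-- The bit machine that simulates `T` on the first `m` cells of the tape and returns to the initial
configuration for the input `w` when `T` accepts. -/
noncomputable def bitMachine (w : List Bool) (m : ℕ) : BitMachine where
  size := m * T.numSymbols
  ctrl := m * T.numLocal
  addr c := T.addrLocal m (c / T.numLocal) (T.localOf c)
  wr c := T.wrLocal w (c / T.numLocal) (T.localOf c)
  next c v := T.nextLocal m (c / T.numLocal) v (T.localOf c)
  next_lt c v hc := by
    have hh : c / T.numLocal < m := Nat.div_lt_of_lt_mul (by rwa [mul_comm])
    have h0 : 0 < m := (Nat.zero_le _).trans_lt hh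
    unfold nextLocal foundLocal
    split
    · rename_i q j _
      split_ifs
      · cases T.trans q (T.symbolEquiv.symm j) <;> exact T.codeOf_lt ‹_› _
      · cases T.trans q (T.symbolEquiv.symm j) <;> exact T.codeOf_lt ‹_› _
      all_goals exact T.codeOf_lt ‹_› _
    · split_ifs <;> exact T.codeOf_lt ‹_› _
    · split_ifs <;> exact T.codeOf_lt ‹_› _
    · exact T.codeOf_lt ‹_› _

/-- The bits that represent a tape. -/
noncomputable def memOf (tape : ℕ → T.Symbol) (t : ℕ) : Bool :=
  decide ((T.symbolEquiv (tape (t / T.numSymbols)) : ℕ) = t % T.numSymbols)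

/-! ### Simulation of the Turing machine by the bit machine -/

variable {T}

theorem step_read {w : List Bool} {m h : ℕ} (hm : h < m) (e : T.Local) (he : e ≠ .stuck)
    (mem : ℕ → Bool) :
    (T.bitMachine w m).Step (T.codeOf h e, mem)
      (T.nextLocal m h (mem (T.addrLocal m h e)) e,
        update mem (T.addrLocal m h e) (T.wrLocal w h e)) := by
  refine ⟨?_, ?_⟩
  · simp only [bitMachine, codeOf_div, localOf_codeOf]
    have h2 : (h + 1) * T.numSymbols ≤ m * T.numSymbols := Nat.mul_le_mul_right _ hm
    rw [Nat.succ_mul] at h2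
    cases e with
    | stuck => exact absurd rfl he
    | read q j => have := j.isLt; simp only [addrLocal]; omega
    | write q j d => have := j.isLt; simp only [addrLocal]; omega
    | reset j => have := j.isLt; simp only [addrLocal]; omega
  · simp only [bitMachine, codeOf_div, localOf_codeOf]

theorem cell_div (h : ℕ) (j : Fin T.numSymbols) :
    (h * T.numSymbols + j) / T.numSymbols = h := by
  rw [add_comm, Nat.add_mul_div_right _ _ T.numSymbols_pos, Nat.div_eq_of_lt j.isLt, zero_add]

theorem cell_mod (h : ℕ) (j : Fin T.numSymbols) :
    (h * T.numSymbols + j) % T.numSymbols = j := by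
  rw [add_comm, Nat.add_mul_mod_self_right, Nat.mod_eq_of_lt j.isLt]

theorem memOf_cell (tape : ℕ → T.Symbol) (h : ℕ) (j : Fin T.numSymbols) :
    T.memOf tape (h * T.numSymbols + j) = decide (T.symbolEquiv (tape h) = j) := by
  rw [memOf, cell_div, cell_mod]
  simp [Fin.ext_iff]

/-- The bit machine finds the symbol under the head. -/
theorem steps_find {w : List Bool} {m h : ℕ} (hm : h < m) (q : T.State) (tape : ℕ → T.Symbol)
    (j : Fin T.numSymbols) (hj : j ≤ T.symbolEquiv (tape h)) :
    Relation.ReflTransGen (T.bitMachine w m).Step (T.codeOf h (.read q j), T.memOf tape)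
      (T.codeOf h (.read q (T.symbolEquiv (tape h))), T.memOf tape) := by
  induction hd : (T.symbolEquiv (tape h) : ℕ) - j generalizing j with
  | zero =>
    have : j = T.symbolEquiv (tape h) := le_antisymm hj (by rw [Fin.le_def]; omega)
    rw [this]
  | succ d ih =>
    have hne : T.symbolEquiv (tape h) ≠ j := fun h' => by rw [h'] at hd; omega
    have hlt := (T.symbolEquiv (tape h)).isLt
    have hs := step_read (w := w) hm (.read q j) (by simp) (T.memOf tape)
    have h0 : T.memOf tape (h * T.numSymbols + j) = false := by
      rw [memOf_cell]
      simpa using hne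
    have hu : update (T.memOf tape) (h * T.numSymbols + j) false = T.memOf tape := by
      rw [← h0, update_eq_self]
    simp only [addrLocal, wrLocal, h0, hu, nextLocal] at hs
    rw [if_neg (by simp), dif_pos (by omega)] at hs
    exact .head hs (ih ⟨j + 1, by omega⟩ (by rw [Fin.le_def]; dsimp only; omega)
      (by dsimp only; omega))

/-- The bit machine after the search for the symbol under the head. -/
theorem steps_read {w : List Bool} {m h : ℕ} (hm : h < m) (q : T.State) (tape : ℕ → T.Symbol) :
    Relation.TransGen (T.bitMachine w m).Step (T.codeOf h (.read q T.firstSymbol), T.memOf tape)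
      (T.foundLocal h q (T.symbolEquiv (tape h)),
        update (T.memOf tape) (h * T.numSymbols + T.symbolEquiv (tape h)) false) := by
  have hs := step_read (w := w) hm (.read q (T.symbolEquiv (tape h))) (by simp) (T.memOf tape)
  simp only [addrLocal, wrLocal, nextLocal, memOf_cell, decide_true, if_true] at hs
  exact .tail' (steps_find hm q tape _ (Nat.zero_le _)) hs

theorem memOf_update (tape : ℕ → T.Symbol) (h : ℕ) (γ : T.Symbol) :
    update (update (T.memOf tape) (h * T.numSymbols + T.symbolEquiv (tape h)) false)
      (h * T.numSymbols + T.symbolEquiv γ) true = T.memOf (update tape h γ) := by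
  funext t
  obtain ⟨x, j, rfl⟩ : ∃ (x : ℕ) (j : Fin T.numSymbols), t = x * T.numSymbols + j :=
    ⟨t / T.numSymbols, ⟨t % T.numSymbols, Nat.mod_lt _ T.numSymbols_pos⟩,
      (Nat.div_add_mod' _ _).symm⟩
  have inj : ∀ (x' : ℕ) (j' : Fin T.numSymbols),
      x * T.numSymbols + j = x' * T.numSymbols + j' ↔ x = x' ∧ j = j' := by
    refine fun x' j' => ⟨fun h' => ⟨?_, ?_⟩, by rintro ⟨rfl, rfl⟩; rfl⟩
    · rw [← cell_div x j, h', cell_div]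
    · exact Fin.ext (by rw [← cell_mod x j, h', cell_mod])
  simp only [update_apply, inj, memOf_cell]
  by_cases hx : x = h
  · subst hx
    by_cases h1 : j = T.symbolEquiv γ
    · simp [h1]
    · have h1' : ¬ T.symbolEquiv γ = j := Ne.symm h1
      simp only [h1, and_false, if_false, if_true, h1', decide_false, true_and]
      split_ifs with h2
      · rfl
      · simp [Ne.symm h2]
  · simp [hx]

/-- The bit machine simulates a step of `T`. -/
theorem steps_step {w : List Bool} {m : ℕ} {c c' : T.Cfg} (hm : c.head < m) (hm' : c'.head < m)
    (hc : c' ∈ T.step c) :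
    Relation.TransGen (T.bitMachine w m).Step
      (T.codeOf c.head (.read c.state T.firstSymbol), T.memOf c.tape)
      (T.codeOf c'.head (.read c'.state T.firstSymbol), T.memOf c'.tape) := by
  obtain ⟨r, hr, rfl⟩ := Option.map_eq_some_iff.1 hc
  have h1 := steps_read (w := w) hm c.state c.tape
  have hf : T.foundLocal c.head c.state (T.symbolEquiv (c.tape c.head)) =
      T.codeOf c.head (.write r.1 (T.symbolEquiv r.2.1) r.2.2) := by
    simp [foundLocal, hr]
  rw [hf] at h1
  have h2 := step_read (w := w) hm (.write r.1 (T.symbolEquiv r.2.1) r.2.2) (by simp)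
    (update (T.memOf c.tape) (c.head * T.numSymbols + T.symbolEquiv (c.tape c.head)) false)
  simp only [addrLocal, wrLocal, nextLocal, memOf_update] at h2
  rw [if_pos hm'] at h2
  exact h1.tail h2

/-- The bit machine restores the initial tape. -/
theorem steps_reset {w : List Bool} {m h : ℕ} (hm : h < m) (j : Fin T.numSymbols) (mem : ℕ → Bool)
    (hmem : ∀ t < h * T.numSymbols + j, mem t = T.memOf (T.init w).tape t) :
    ∃ mem', Relation.TransGen (T.bitMachine w m).Step (T.codeOf h (.reset j), mem)
        (T.codeOf 0 (.read T.start T.firstSymbol), mem') ∧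
      ∀ t < m * T.numSymbols, mem' t = T.memOf (T.init w).tape t := by
  have hj := j.isLt
  have h2 : (h + 1) * T.numSymbols ≤ m * T.numSymbols := Nat.mul_le_mul_right _ hm
  rw [Nat.succ_mul] at h2
  -- The measure is the number of bits not yet restored; the next one is in the same cell or is the
  -- first of the next cell.
  induction hd : m * T.numSymbols - (h * T.numSymbols + j) using Nat.strong_induction_on
    generalizing h j mem with
  | _ d ih =>
    have hs := step_read (w := w) hm (.reset j) (by simp) mem
    simp only [addrLocal, wrLocal, nextLocal] at hs
    set mem1 := update mem (h * T.numSymbols + j) (T.initBit w h j) with hmem1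
    have hm1 : ∀ t < h * T.numSymbols + j + 1, mem1 t = T.memOf (T.init w).tape t := by
      intro t ht
      rcases eq_or_ne t (h * T.numSymbols + j) with rfl | h'
      · rw [hmem1, update_self, memOf_cell, initBit]
        simp [Fin.ext_iff]
      · rw [hmem1, update_of_ne h', hmem t (by omega)]
    split_ifs at hs with h1 h3
    · obtain ⟨mem', h4, h5⟩ := ih _ (by simp only; omega) hm ⟨j + 1, h1⟩ mem1 hm1 h1 h2 rfl
      exact ⟨mem', .head hs h4, h5⟩
    · have h6 : (h + 1 + 1) * T.numSymbols ≤ m * T.numSymbols := Nat.mul_le_mul_right _ h3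
      have h7 : (T.firstSymbol : ℕ) = 0 := rfl
      rw [Nat.succ_mul, Nat.succ_mul] at h6
      obtain ⟨mem', h4, h5⟩ := ih _ (by rw [Nat.succ_mul, h7]; omega) h3 T.firstSymbol mem1
        (fun t ht => hm1 t (by rw [Nat.succ_mul, h7] at ht; omega)) T.firstSymbol.isLt
        (by rw [Nat.succ_mul]; exact h6) rfl
      exact ⟨mem', .head hs h4, h5⟩
    · refine ⟨mem1, .single hs, fun t ht => hm1 t ?_⟩
      have : h + 1 = m := by omega
      rw [← this, Nat.succ_mul] at ht
      omega

theorem steps_reaches {w : List Bool} {m : ℕ} {c : T.Cfg}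
    (hm : ∀ c, StateTransition.Reaches T.step (T.init w) c → c.head < m)
    (hc : StateTransition.Reaches T.step (T.init w) c) :
    Relation.ReflTransGen (T.bitMachine w m).Step
      (T.codeOf 0 (.read T.start T.firstSymbol), T.memOf (T.init w).tape)
      (T.codeOf c.head (.read c.state T.firstSymbol), T.memOf c.tape) := by
  induction hc with
  | refl => exact .refl
  | tail h1 h2 ih => exact ih.trans (steps_step (hm _ h1) (hm _ (h1.tail h2)) h2).to_reflTransGen

/-- The initial profile of the game for `T` and an input belongs to a sink equilibrium if and only
if the input is in the language that `T` decides. -/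
theorem mem_sink_iff {L : Set (List Bool)} {p : ℕ → ℕ} (hT : T.DecidesInSpace L p) (w : List Bool) :
    w ∈ L ↔ ∃ S, (T.bitMachine w (p w.length)).game.toStrategicGame.IsSinkEquilibrium S ∧
      (T.bitMachine w (p w.length)).encode
        (T.codeOf 0 (.read T.start T.firstSymbol), T.memOf (T.init w).tape) ∈ S := by
  obtain ⟨hm, c, hc, hhalt, hacc⟩ := hT w
  have h0 : 0 < p w.length := hm _ .refl
  -- Even if `T` halts at once, the search for the symbol takes a step, so the path is nonempty, as
  -- both directions require.
  have h1 := Relation.TransGen.trans_right (steps_reaches hm hc)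
    (steps_read (w := w) (hm c hc) c.state c.tape)
  have hnone : T.trans c.state (c.tape c.head) = none := by simpa [step] using hhalt
  constructor
  · intro hw
    have hf : T.foundLocal c.head c.state (T.symbolEquiv (c.tape c.head)) =
        T.codeOf 0 (.reset T.firstSymbol) := by
      simp [foundLocal, hnone, hacc.2 hw]
    rw [hf] at h1
    -- From the first bit on, resetting presupposes nothing about the memory, so the bit cleared by
    -- the last search does no harm.
    obtain ⟨mem', h2, h3⟩ := steps_reset h0 T.firstSymbol (w := w) _
      (fun t ht => by simp [firstSymbol] at ht)
    exact BitMachine.mem_sink_of_recurrent (T.codeOf_lt h0 _) (h1.trans h2) h3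
  · rintro ⟨S, hS, hmem⟩
    by_contra hw
    have hf : T.foundLocal c.head c.state (T.symbolEquiv (c.tape c.head)) =
        T.codeOf c.head .stuck := by
      simp [foundLocal, hnone, mt hacc.1 hw]
    rw [hf] at h1
    refine BitMachine.not_mem_sink_of_halts (T.codeOf_lt h0 _) h1 ?_ S hS hmem
    simp [bitMachine, addrLocal]

end TapeMachine

/-! ### The reduction is computable in polynomial time -/

namespace TapeMachine

variable {T : TapeMachine}

theorem localOf_mod (c : ℕ) : T.localOf (c % T.numLocal) = T.localOf c := by
  simp [localOf]

/-- The number of local states depends on `T` alone, so this is a case distinction with a constant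
number of branches, in each of which the local state is a constant. -/
theorem polyDef_localOf {F : List Bool → (ℕ → ℕ) → ℕ} (hF : PolyDef F)
    {H : T.Local → List Bool → (ℕ → ℕ) → ℕ} (hH : ∀ e, PolyDef (H e)) :
    PolyDef fun w v => H (T.localOf (F w v)) w v :=
  (PolyDef.cases (H := fun j => H (T.localOf j)) (hF.modConst T.numLocal)
    (fun _ _ => Nat.mod_lt _ T.numLocal_pos) fun _ _ => hH _).congr fun w v => by rw [localOf_mod]

theorem polyPred_localOf {F : List Bool → (ℕ → ℕ) → ℕ} (hF : PolyDef F)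
    {H : T.Local → List Bool → (ℕ → ℕ) → Prop} (hH : ∀ e, PolyPred (H e)) :
    PolyPred fun w v => H (T.localOf (F w v)) w v :=
  (PolyPred.cases (p := fun j => H (T.localOf j)) (hF.modConst T.numLocal)
    (fun _ _ => Nat.mod_lt _ T.numLocal_pos) fun _ _ => hH _).congr fun w v => by rw [localOf_mod]

variable {F G : List Bool → (ℕ → ℕ) → ℕ}

theorem polyDef_codeOf (hF : PolyDef F) (e : T.Local) : PolyDef fun w v => T.codeOf (F w v) e :=
  (hF.mul (.const _)).add (.const _)

/-- The numbers of the blank and of the two input symbols are constants of `T`; only the input bit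
and the comparison with the length of the input have to be computed. -/
theorem polyPred_initBit (hF : PolyDef F) (j : ℕ) :
    PolyPred fun w v => T.initBit w (F w v) j = true := by
  refine PolyPred.congr (p := fun w v =>
    (w[F w v]? = some true ∧ (T.symbolEquiv (T.input true) : ℕ) = j) ∨
    ((¬ w[F w v]? = some true ∧ F w v < w.length) ∧ (T.symbolEquiv (T.input false) : ℕ) = j) ∨
    (¬ F w v < w.length ∧ (T.symbolEquiv T.blank : ℕ) = j))
    (((PolyPred.inputBit hF).and (.const _)).or ((((PolyPred.inputBit hF).not.and (.lt hF .length)).and (.const _)).or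
      ((PolyPred.lt hF .length).not.and (.const _)))) fun w v => ?_
  unfold initBit
  rw [decide_eq_true_iff]
  change _ ↔ (T.symbolEquiv ((w[F w v]?).elim T.blank T.input) : ℕ) = j
  rcases lt_or_ge (F w v) w.length with h | h
  · rw [List.getElem?_eq_getElem h]
    cases w[F w v] <;> simp [h]
  · rw [List.getElem?_eq_none h]
    simp [h]

variable (T) in
/-- The bit machine of `T` for the space bound `P`. -/
noncomputable abbrev polyMachine (P : Polynomial ℕ) (w : List Bool) : BitMachine :=
  T.bitMachine w (P.eval w.length)

variable (P : Polynomial ℕ)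

theorem polyDef_space : PolyDef fun w _ => P.eval w.length := PolyDef.length.polynomial P

theorem polyDef_size : PolyDef fun w _ => (T.polyMachine P w).size :=
  (polyDef_space P).mul (.const _)

theorem polyDef_ctrl : PolyDef fun w _ => (T.polyMachine P w).ctrl :=
  (polyDef_space P).mul (.const _)

theorem polyDef_addr (hF : PolyDef F) : PolyDef fun w v => (T.polyMachine P w).addr (F w v) := by
  refine polyDef_localOf (H := fun e w v => T.addrLocal (P.eval w.length) (F w v / T.numLocal) e) hF
    fun e => ?_
  have hd := hF.divConst T.numLocal
  cases e with
  | stuck => exact (polyDef_space P).mul (.const _)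
  | _ => exact (hd.mul (.const _)).add (.const _)

theorem polyPred_wr (hF : PolyDef F) : PolyPred fun w v => (T.polyMachine P w).wr (F w v) = true := by
  refine polyPred_localOf (H := fun e w v => T.wrLocal w (F w v / T.numLocal) e = true) hF
    fun e => ?_
  cases e with
  | read => exact .const (false = true)
  | write => exact .const (true = true)
  | reset j => exact polyPred_initBit (hF.divConst T.numLocal) j
  | stuck => exact .const (false = true)

theorem polyDef_next {p : List Bool → (ℕ → ℕ) → Prop} [∀ w v, Decidable (p w v)] (hF : PolyDef F)
    (hp : PolyPred p) : PolyDef fun w v => (T.polyMachine P w).next (F w v) (decide (p w v)) := by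
  refine polyDef_localOf (H := fun e w v =>
    T.nextLocal (P.eval w.length) (F w v / T.numLocal) (decide (p w v)) e) hF fun e => ?_
  have hd := hF.divConst T.numLocal
  cases e with
  | read q j =>
    simp only [nextLocal, decide_eq_true_eq]
    refine .ite hp ?_ ?_
    · unfold foundLocal
      cases T.trans q (T.symbolEquiv.symm j) with
      | none =>
        simp only [Option.elim]
        split_ifs
        · exact .const _
        · exact polyDef_codeOf hd _
      | some r => exact polyDef_codeOf hd _
    · split_ifs
      · exact polyDef_codeOf hd _
      · exact polyDef_codeOf hd _
  | write q j d =>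
    have hm : PolyDef fun w v => move d (F w v / T.numLocal) := by
      cases d with
      | left => exact hd.sub .one
      | right => exact hd.add .one
    exact .ite (.lt hm (polyDef_space P)) (polyDef_codeOf hm _) (polyDef_codeOf hd _)
  | reset j =>
    simp only [nextLocal]
    split_ifs
    · exact polyDef_codeOf hd _
    · exact .ite (.lt (hd.add .one) (polyDef_space P)) (polyDef_codeOf (hd.add .one) _) (.const _)
  | stuck => exact polyDef_codeOf hd _

theorem polyDef_target (hF : PolyDef F) (hG : PolyDef G) :
    PolyDef fun w v => (T.polyMachine P w).target (F w v) (G w v) :=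
  ((PolyDef.const 2).mul (polyDef_next P (hF.divConst 2) (.eq ((hF.add hG).modConst 2) .one))).add
    ((hG.add (.ite (polyPred_wr P (hF.divConst 2)) .one .zero)).modConst 2)

theorem polyDef_wish (hF : PolyDef F) {x : List Bool → (ℕ → ℕ) → ℕ → ℕ}
    (hx : ∀ j, PolyDef fun w v => x w v j) :
    PolyDef fun w v => (T.polyMachine P w).wish (F w v) (x w v) := by
  have hs := polyDef_size (T := T) P
  have hL := (PolyDef.const 2).mul (polyDef_ctrl (T := T) P)
  have ha := polyDef_addr (T := T) P ((hx 3).divConst 2)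
  have hw := polyPred_wr (T := T) P ((hx 3).divConst 2)
  have ht := polyDef_target (T := T) P (hx 3) (hx 1)
  have h56 := (PolyPred.eq (hx 5) .zero).and (PolyPred.eq (hx 6) .zero)
  refine .ite (.lt hF hs) (.ite (h56.and (.eq ha hF)) (.const 2)
    (.ite ((PolyPred.eq (hx 5) .one).and (.eq ha hF)) (.ite hw .one .zero) (.const 7))) ?_
  refine .ite (.lt hF (hs.add hL)) (.ite ((PolyPred.eq (hx 6) .one).and (.eq hF (hs.add (hx 3))))
    (.ite (.lt (hx 3) (hx 4)) (.const 3) .zero) (.const 7)) ?_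
  refine .ite (.lt hF ((hs.add hL).add hL)) (.ite ((h56.and (.eq (hx 2) .one)).and
    (.eq hF ((hs.add hL).add (hx 4)))) (.ite (.lt (hx 4) ht) (.const 4) .zero) (.const 7)) ?_
  exact .ite (.eq (hx 2) .one) (.ite (.eq (hx 4) ht) (.const 5) (.const 7))
    (.ite (.eq (hx 3) (hx 4)) .zero (.const 6))

theorem polyDef_players : PolyDef fun w _ => (T.polyMachine P w).players := by
  have hL := (PolyDef.const 2).mul (polyDef_ctrl (T := T) P)
  exact (((polyDef_size P).add hL).add hL).add .one

theorem polyPred_memOf (hF : PolyDef F) :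
    PolyPred fun w v => T.memOf (T.init w).tape (F w v) = true :=
  PolyPred.cases (p := fun j w v => T.initBit w (F w v / T.numSymbols) j = true)
    (hF.modConst T.numSymbols) (fun _ _ => Nat.mod_lt _ T.numSymbols_pos)
    fun _ _ => polyPred_initBit (hF.divConst _) _

/-! #### The reduction -/

variable (T)

/-- The initial configuration of the bit machine. -/
noncomputable def startCfg (w : List Bool) : ℕ × (ℕ → Bool) :=
  (T.codeOf 0 (.read T.start T.firstSymbol), T.memOf (T.init w).tape)

/-- The reduction. -/
noncomputable def reduction (w : List Bool) : SinkInstance 7 where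
  n := (T.polyMachine P w).players
  game := (T.polyMachine P w).game
  profile := (T.polyMachine P w).encode (T.startCfg w)

/-- The code of the initial configuration. -/
noncomputable def startCode (w : List Bool) : ℕ :=
  BitMachine.code (T.startCfg w).1 ((T.polyMachine P w).bitCount (BitMachine.bits (T.startCfg w).2) 1)

variable {T}

theorem polyDef_startCode : PolyDef fun w _ => T.startCode P w := by
  have h : PolyDef fun w _ => 2 * T.codeOf 0 (.read T.start T.firstSymbol) +
      (∑ t ∈ Finset.range (T.polyMachine P w).size,
        if BitMachine.bits (T.startCfg w).2 t = 1 then 1 else 0) % 2 := by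
    refine (PolyDef.const _).add (PolyDef.modConst (PolyDef.sum
      (G := fun w _ t => if BitMachine.bits (T.startCfg w).2 t = 1 then 1 else 0)
      (polyDef_size P) (.ite (PolyPred.congr (polyPred_memOf (T := T) (.var 0)) fun w v => ?_)
        .one .zero)) 2)
    simp only [BitMachine.bits, startCfg]
    split_ifs with h <;> simp [h]
  exact h

theorem polyWord_profile : PolyWord fun w _ => (List.range (T.polyMachine P w).players).flatMap
    fun i => [InstanceSymbol.strategy (k := 7) ((T.polyMachine P w).prof
      (BitMachine.bits (T.startCfg w).2) (T.startCode P w) (T.startCode P w) 0 i)] := by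
  have hL := (PolyDef.const 2).mul (polyDef_ctrl (T := T) P)
  have hs := polyDef_size (T := T) P
  have hc := polyDef_startCode (T := T) P
  refine PolyWord.flatMap_range (polyDef_players P) (L := fun w _ i =>
    [InstanceSymbol.strategy (k := 7) ((T.polyMachine P w).prof
      (BitMachine.bits (T.startCfg w).2) (T.startCode P w) (T.startCode P w) 0 i)]) ?_
  refine (PolyWord.ite (.lt (.var 0) hs) (.ite (polyPred_memOf (T := T) (.var 0))
    (.singleton (.strategy 1)) (.singleton (.strategy 0)))
    (.ite (.lt (.var 0) (hs.add hL)) (.ite (.lt (.var 0) (hs.add hc)) (.singleton (.strategy 3))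
      (.singleton (.strategy 0)))
    (.ite (.lt (.var 0) ((hs.add hL).add hL)) (.ite (.lt (.var 0) ((hs.add hL).add hc))
      (.singleton (.strategy 4)) (.singleton (.strategy 0))) (.singleton (.strategy 0))))).congr
    fun w v => ?_
  unfold BitMachine.prof BitMachine.bits startCfg
  split_ifs <;> rfl

theorem polyWord_table : PolyWord fun w _ => (List.range (T.polyMachine P w).players).flatMap
    fun i => (List.finRange 7).flatMap fun a : Fin 7 =>
      (List.Nat.antidiagonalTuple 7 ((T.polyMachine P w).players - 1)).flatMap fun x =>
        [InstanceSymbol.util (k := 7)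
          (if (T.polyMachine P w).wish i (BitMachine.ext7 x) = (a : ℕ) then 1 else 0)] := by
  refine PolyWord.flatMap_range (polyDef_players P) (L := fun w _ i =>
    (List.finRange 7).flatMap fun a : Fin 7 =>
      (List.Nat.antidiagonalTuple 7 ((T.polyMachine P w).players - 1)).flatMap fun x =>
        [InstanceSymbol.util (k := 7)
          (if (T.polyMachine P w).wish i (BitMachine.ext7 x) = (a : ℕ) then 1 else 0)]) ?_
  refine PolyWord.flatMap_list _ fun a _ => ?_
  refine PolyWord.flatMap_antidiagonalTuple 7 ((polyDef_players P).sub .one) (L := fun w v x =>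
    [InstanceSymbol.util (k := 7)
      (if (T.polyMachine P w).wish (v 0) (BitMachine.ext7 x) = (a : ℕ) then 1 else 0)]) ?_
  have hx : ∀ j, PolyDef fun (_ : List Bool) (v : ℕ → ℕ) =>
      BitMachine.ext7 (fun j : Fin 7 => v (7 - 1 - j)) j := by
    intro j
    unfold BitMachine.ext7
    split_ifs
    · exact .var _
    · exact .zero
  -- The seven entries of the partition are pushed in front of the player's index, which therefore
  -- becomes variable 7.
  refine (PolyWord.ite (.eq (polyDef_wish (T := T) P (.var (0 + 7)) hx) (.const a))
    (.singleton (.util 1)) (.singleton (.util 0))).congr fun w v => ?_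
  split_ifs <;> rfl

theorem flatMap_finRange {α : Type} (n : ℕ) (f : ℕ → List α) :
    ((List.finRange n).flatMap fun i : Fin n => f i) = (List.range n).flatMap f := by
  rw [← List.map_coe_finRange_eq_range, List.flatMap_map]

/-- Players become natural numbers and partitions plain tuples, so that the encoding is a
concatenation of words already known to be definable. -/
theorem encode_reduction (w : List Bool) :
    (T.reduction P w).encode = List.replicate (T.polyMachine P w).players InstanceSymbol.tick ++
      ([InstanceSymbol.sep] ++
        (((List.range (T.polyMachine P w).players).flatMap
          fun i => (List.finRange 7).flatMap fun a : Fin 7 =>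
            (List.Nat.antidiagonalTuple 7 ((T.polyMachine P w).players - 1)).flatMap fun x =>
              [InstanceSymbol.util (k := 7)
                (if (T.polyMachine P w).wish i (BitMachine.ext7 x) = (a : ℕ) then 1 else 0)]) ++
        ((List.range (T.polyMachine P w).players).flatMap
          fun i => [InstanceSymbol.strategy (k := 7) ((T.polyMachine P w).prof
            (BitMachine.bits (T.startCfg w).2) (T.startCode P w) (T.startCode P w) 0 i)]))) := by
  rw [← flatMap_finRange, ← flatMap_finRange]
  simp only [SinkInstance.encode, SinkInstance.utilityTable, allPartitions, reduction, List.map_map,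
    BitMachine.game, BitMachine.encode, BitMachine.profile, startCode,
    List.singleton_append, ← List.map_eq_flatMap]
  congr 3
  refine List.flatMap_congr fun i _ => List.flatMap_congr fun a _ => ?_
  exact List.attach_map_val (f := fun x => InstanceSymbol.util (k := 7)
    (if (T.polyMachine P w).wish i (BitMachine.ext7 x) = (a : ℕ) then 1 else 0))

theorem computable_reduction :
    Nonempty (Turing.TM2ComputableInPolyTime (Computability.encodingList Bool).encode
      (SinkInstance.encoding 7).encode (T.reduction P)) :=
  PolyWord.tm2ComputableInPolyTime _ _
    (((PolyWord.replicate (polyDef_players P) _).append ((PolyWord.singleton _).append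
      ((polyWord_table P).append (polyWord_profile P)))).congr
        fun w _ => (encode_reduction P w).symm)

end TapeMachine

/-- There is a constant number `k` of strategies for which the problem In a Sink is PSPACE-hard for
anonymous games with `k` strategies and utilities in `{0, 1, 2}`. -/
theorem mainTheorem3 : ∃ k : ℕ, PSPACEHard (SinkInstance.encoding k) (InASink k) := by
  refine ⟨7, fun L hL => ?_⟩
  obtain ⟨T, P, hT⟩ := hL
  exact ⟨T.reduction P, TapeMachine.computable_reduction P, TapeMachine.mem_sink_iff hT⟩
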